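/- An unrooted (pinned) tree is a contractible finite graph with legs (finite sets of edges and of vertices, and a neighbourhood $\mathrm{nb}(v)$, a set of edges, for each vertex $v$, such that every edge lies in at most two neighbourhoods) which has at least one leg, together with bijections $\mathrm{ord}^v:\{0,\dots,n_v\}\to \mathrm{nb}(v)$ for all vertices $v$ and an ordering $\{0,\dots,n\}\to \mathrm{legs}(S)$ of the legs (a bijection if there is a vertex, and otherwise the unique map from $\{0,1\}$ to the single edge). A subgraph of a tree is a contractible graph formed by some of its vertices and edges that contains all edges incident to its vertices; its boundary is the unordered list of its legs, except that the boundary of a single edge $|_e$ is $e,e$. Let $\Xi$ be the category of unrooted trees, whose morphisms $\phi:R\to S$ are pairs of a map $\phi_0$ from the edges of $R$ to the edges of $S$ and a map $\phi_1$ from the subgraphs of $R$ to the subgraphs of $S$ such that $\phi_1$ and $\phi_0$ are compatible with boundaries, and $\phi_1$ sends overlapping subgraphs to overlapping subgraphs and preserves their intersections and unions. Let $\mathbf{Cyc}$ be the category of colored cyclic operads in sets. For a tree $S$ let $C(S)$ be the free colored cyclic operad with color set the set of edges of $S$ generated by the vertices of $S$, where the vertex $v$ is a generator in $C(S)(\mathrm{ord}^v(1),\dots,\mathrm{ord}^v(n_v);\mathrm{ord}^v(0))$.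 Each subgraph of $S$ with an ordering of its legs (for $|_e$, the list $e,e$) determines an operation of $C(S)$, the composite of its vertices along its interior edges (for $|_e$, the identity of $e$). **Theorem.** There is a unique functor $C:\Xi\to\mathbf{Cyc}$ which sends each tree $S$ to $C(S)$ and each morphism $\phi:R\to S$ to a map $C(\phi)$ which is $\phi_0$ on colors and which sends the generator $v$, for each vertex $v$ of $R$, to the operation of $C(S)$ determined by the subgraph $\phi_1(v)$ (the image under $\phi_1$ of the subgraph of $R$ consisting of $v$ and its incident edges) with legs ordered by $\phi_0\circ\mathrm{ord}^v$. This functor $C$ is faithful, but it is not full. -/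

import Mathlib

open CategoryTheory

universe u

/-! ## Undirected graphs with legs and unrooted trees -/

/-- An undirected graph with legs: finite sets of edges and vertices and a neighbourhood function
`nbhd : Vert → 𝒫 Edge`, such that every edge lies in at most two neighbourhoods. -/
structure LegGraph where
  Edge : Type u
  Vert : Type u
  finite_edge : Finite Edge
  finite_vert : Finite Vert
  nbhd : Vert → Set Edge
  incident_le_two : ∀ e : Edge, {v | e ∈ nbhd v}.encard ≤ 2

namespace LegGraph

variable (G : LegGraph.{u})

/-- The bipartite incidence graph of `G`: its nodes are the vertices and the edges of `G`, and a
vertex `v` is joined to each `e ∈ nbhd v`.  (This is the red-white-black graph of `G`: the vertices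
of `G` are black, the interior edges are white and the legs are red.)  The space underlying `G`
is contractible exactly when this graph is a tree. -/
def incidence : SimpleGraph (G.Vert ⊕ G.Edge) :=
  SimpleGraph.fromRel fun x y => ∃ v e, x = Sum.inl v ∧ y = Sum.inr e ∧ e ∈ G.nbhd v

/-- The edges in `E` that are incident to at most one vertex in `V` (for `V`, `E` everything: the
legs of `G`). -/
def legsOf (V : Set G.Vert) (E : Set G.Edge) : Set G.Edge :=
  {e ∈ E | ¬ ∃ v ∈ V, ∃ w ∈ V, v ≠ w ∧ e ∈ G.nbhd v ∧ e ∈ G.nbhd w}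

/-- The legs of `G`, i.e. the edges that are not interior. -/
def legs : Set G.Edge := G.legsOf Set.univ Set.univ

end LegGraph

/-- A (pinned) unrooted tree: a contractible graph with legs, with a total ordering
`{0, …, n_v} ≃ nbhd v` of the neighbourhood of each vertex, and an ordering `{0, …, n} → legs`
of the legs which is a bijection if there is a vertex, and otherwise is the unique map from `{0, 1}`
to the single edge. (In particular there is at least one leg.) -/
structure UTree extends LegGraph.{u} where
  contractible : toLegGraph.incidence.IsTree
  /-- the number `n_v`, one less than the valence of `v` -/
  ar : Vert → ℕ
  ordV : ∀ v, Fin (ar v + 1) ≃ nbhd v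
  /-- the number `n`, one less than the number of labels:
  the legs are labelled by `0, …, n` -/
  arity : ℕ
  ord : Fin (arity + 1) → toLegGraph.legs
  ord_bijective : Nonempty Vert → Function.Bijective ord
  ord_of_isEmpty : IsEmpty Vert → arity = 1

namespace UTree

/-- A subgraph of a tree: a set of vertices and a set of edges, containing all edges incident to
any of its vertices, such that the resulting graph is contractible. -/
@[ext]
structure Subgraph (S : UTree.{u}) where
  verts : Set S.Vert
  edges : Set S.Edge
  nbhd_subset : ∀ v ∈ verts, S.nbhd v ⊆ edges
  contractible : (S.incidence.induce (Sum.inl '' verts ∪ Sum.inr '' edges)).IsTree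

namespace Subgraph

variable {S : UTree.{u}}

/-- The legs of a subgraph. -/
def legs (T : S.Subgraph) : Set S.Edge := S.legsOf T.verts T.edges

/-- The subgraph `|_e` consisting of a single edge `e` and no vertices. -/
def edge (e : S.Edge) : S.Subgraph where
  verts := ∅
  edges := {e}
  nbhd_subset := by simp
  contractible := by
    have : Subsingleton
        ↑((Sum.inl '' (∅ : Set S.Vert) ∪ Sum.inr '' {e} : Set (S.Vert ⊕ S.Edge))) := by
      simp only [Set.image_empty, Set.image_singleton, Set.empty_union]
      infer_instance
    have : Nonempty
        ↑((Sum.inl '' (∅ : Set S.Vert) ∪ Sum.inr '' {e} : Set (S.Vert ⊕ S.Edge))) :=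
      ⟨⟨Sum.inr e, by simp⟩⟩
    exact SimpleGraph.IsTree.of_subsingleton

/-- The subgraph consisting of a single vertex `v` and all edges incident to `v`. -/
def star (v : S.Vert) : S.Subgraph where
  verts := {v}
  edges := S.nbhd v
  nbhd_subset := by simp
  contractible := by
    refine ⟨?_, S.contractible.isAcyclic.induce _⟩
    have key : ∀ x : ↑((Sum.inl '' {v} ∪ Sum.inr '' S.nbhd v : Set (S.Vert ⊕ S.Edge))),
        (S.incidence.induce _).Reachable ⟨Sum.inl v, by simp⟩ x := by
      rintro ⟨x, hx⟩
      rcases hx with ⟨w, hw, rfl⟩ | ⟨e, he, rfl⟩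
      · obtain rfl : w = v := hw
        exact SimpleGraph.Reachable.refl _
      · apply SimpleGraph.Adj.reachable
        simp only [SimpleGraph.comap_adj, Function.Embedding.subtype_apply, LegGraph.incidence,
          SimpleGraph.fromRel_adj]
        exact ⟨by simp, Or.inl ⟨v, e, rfl, rfl, he⟩⟩
    have : Nonempty ↑((Sum.inl '' {v} ∪ Sum.inr '' S.nbhd v : Set (S.Vert ⊕ S.Edge))) :=
      ⟨⟨Sum.inl v, by simp⟩⟩
    exact ⟨fun x y => (key x).symm.trans (key y)⟩

open Classical in
/-- The boundary of a subgraph, in the free commutative monoid on the edges (written as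
multisets): the unordered list of its legs, except that the boundary of `|_e` is `e, e`. -/
noncomputable def boundary (T : S.Subgraph) : Multiset S.Edge :=
  haveI := S.finite_edge
  if ∃ e, T = edge e then 2 • T.edges.toFinite.toFinset.val else T.legs.toFinite.toFinset.val

/-- Two subgraphs overlap if their intersection is nonempty. -/
def Overlap (T T' : S.Subgraph) : Prop :=
  (T.verts ∩ T'.verts).Nonempty ∨ (T.edges ∩ T'.edges).Nonempty

/-- `I = T ∩ T'`. -/
def IsInter (I T T' : S.Subgraph) : Prop :=
  I.verts = T.verts ∩ T'.verts ∧ I.edges = T.edges ∩ T'.edges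

/-- `U = T ∪ T'`. -/
def IsUnion (U T T' : S.Subgraph) : Prop :=
  U.verts = T.verts ∪ T'.verts ∧ U.edges = T.edges ∪ T'.edges

end Subgraph

/-- A (complete) morphism of trees: a function on edges and a function on subgraphs that are
compatible with boundaries, and such that the function on subgraphs preserves overlapping pairs,
their intersections and their unions. -/
@[ext]
structure Hom (R S : UTree.{u}) where
  onEdge : R.Edge → S.Edge
  onSub : R.Subgraph → S.Subgraph
  boundary_onSub : ∀ T, (onSub T).boundary = T.boundary.map onEdge
  overlap : ∀ {T T' : R.Subgraph}, T.Overlap T' → (onSub T).Overlap (onSub T')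
  inter : ∀ {T T' I : R.Subgraph}, T.Overlap T' → I.IsInter T T' →
    (onSub I).IsInter (onSub T) (onSub T')
  union : ∀ {T T' U : R.Subgraph}, T.Overlap T' → U.IsUnion T T' →
    (onSub U).IsUnion (onSub T) (onSub T')

/-- The category `Ξ` of unrooted trees. -/
instance : Category UTree.{u} where
  Hom := Hom
  id S :=
    { onEdge := id
      onSub := id
      boundary_onSub := by simp
      overlap := id
      inter := fun _ h => h
      union := fun _ h => h }
  comp f g :=
    { onEdge := g.onEdge ∘ f.onEdge
      onSub := g.onSub ∘ f.onSub
      boundary_onSub := fun T => by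
        simp [g.boundary_onSub, f.boundary_onSub, Multiset.map_map]
      overlap := fun h => g.overlap (f.overlap h)
      inter := fun h h' => g.inter (f.overlap h) (f.inter h h')
      union := fun h h' => g.union (f.overlap h) (f.union h h') }

end UTree

/-! ## Colored cyclic operads -/

/-- Grafting of ordered lists.  The legs of an `n`-ary operation are numbered `0, 1, …, n`, with `0`
the output.  If `c = (c₀, …, c_k)` and `d = (d₀, …, d_l)` label the legs of `g` and `f`, then
`graft h i c d = (c₀, …, c_{i-1}, d₁, …, d_l, c_{i+1}, …, c_k)` labels the legs of `g ∘_i f`. -/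
def graft {α : Type*} {k l n : ℕ} (h : n + 1 = k + l) (i : Fin (k + 1))
    (c : Fin (k + 1) → α) (d : Fin (l + 1) → α) : Fin (n + 1) → α := fun j =>
  if h₁ : (j : ℕ) < i then c ⟨j, by omega⟩
  else if h₂ : (j : ℕ) < i + l then d ⟨j - i + 1, by omega⟩
  else c ⟨j + 1 - l, by omega⟩

/-- A colored cyclic operad (in sets).

`Op n` is the set `O_n = ∐ O(c₁, …, c_n; c₀)` of all `n`-ary operations, and
`col x = (c₀, c₁, …, c_n)` records the colors of the output and of the inputs of `x`, so that
`O(c₁, …, c_n; c₀)` is the set of those `x` with `col x = (c₀, …, c_n)`.  There are identities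
`unit a ∈ O(a; a)`, a right action of `Σ_n⁺ = Aut {0, …, n}` on `O_n`, whose restriction to the
stabilizer `Σ_n` of `0` is the symmetric group action of the underlying operad, and partial
compositions `comp _ i _ g f _ = g ∘_i f` (`1 ≤ i ≤ k`), defined if the output color of `f` is the
color of the `i`-th input of `g`. -/
structure CycOperad where
  Color : Type u
  Op : ℕ → Type u
  col : ∀ {n}, Op n → Fin (n + 1) → Color
  unit : Color → Op 1
  act : ∀ {n}, Op n → Equiv.Perm (Fin (n + 1)) → Op n
  comp : ∀ {k l n : ℕ} (_ : n + 1 = k + l) (i : Fin (k + 1)) (_ : i ≠ 0) (g : Op k) (f : Op l)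
    (_ : col f 0 = col g i), Op n
  /- colors -/
  col_unit : ∀ a, col (unit a) = fun _ => a
  col_act : ∀ {n} (x : Op n) σ, col (act x σ) = col x ∘ σ
  col_comp : ∀ {k l n : ℕ} (h : n + 1 = k + l) i hi (g : Op k) (f : Op l) hc,
    col (comp h i hi g f hc) = graft h i (col g) (col f)
  /- right action of `Σ_n⁺` -/
  act_one : ∀ {n} (x : Op n), act x 1 = x
  act_mul : ∀ {n} (x : Op n) σ τ, act x (σ * τ) = act (act x σ) τ
  /- units -/
  comp_unit : ∀ {n} (h : n + 1 = n + 1) i hi (x : Op n) a hc, comp h i hi x (unit a) hc = x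
  unit_comp : ∀ {n} (h : n + 1 = 1 + n) hi (x : Op n) a hc, comp h 1 hi (unit a) x hc = x
  /- sequential associativity: `(x ∘_i y) ∘_{i+j-1} z = x ∘_i (y ∘_j z)` -/
  assoc_seq : ∀ {k l m a b n : ℕ} (x : Op k) (y : Op l) (z : Op m) (i : Fin (k + 1))
    (j : Fin (l + 1)) (p : Fin (a + 1)) hi hj hp (_ : (p : ℕ) + 1 = i + j)
    (ha : a + 1 = k + l) (hb : b + 1 = l + m) (hn : n + 1 = a + m) (hn' : n + 1 = k + b)
    hxy hyz h₁ h₂,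
    comp hn p hp (comp ha i hi x y hxy) z h₁ = comp hn' i hi x (comp hb j hj y z hyz) h₂
  /- parallel associativity: `(x ∘_i y) ∘_{j+l-1} z = (x ∘_j z) ∘_i y` for `i < j` -/
  assoc_par : ∀ {k l m a b n : ℕ} (x : Op k) (y : Op l) (z : Op m) (i j : Fin (k + 1))
    (p : Fin (a + 1)) (q : Fin (b + 1)) hi hj hp hq (_ : i < j)
    (_ : (p : ℕ) + 1 = j + l) (_ : (q : ℕ) = i)
    (ha : a + 1 = k + l) (hb : b + 1 = k + m) (hn : n + 1 = a + m) (hn' : n + 1 = b + l)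
    hxy hxz h₁ h₂,
    comp hn p hp (comp ha i hi x y hxy) z h₁ = comp hn' q hq (comp hb j hj x z hxz) y h₂
  /- equivariance for `σ ∈ Σ_k` and `τ ∈ Σ_l`: `(g · σ) ∘_i (f · τ) = (g ∘_{σ i} f) · ρ`, where
  `ρ = σ ∘_i τ` is the block permutation, i.e. the permutation matching up the legs of the two
  composites, labelled by the legs of `g` and the legs of `f` -/
  equivariance : ∀ {k l n : ℕ} (h : n + 1 = k + l) (i : Fin (k + 1)) hi (g : Op k) (f : Op l)
    (σ : Equiv.Perm (Fin (k + 1))) (τ : Equiv.Perm (Fin (l + 1))) (_ : σ 0 = 0) (_ : τ 0 = 0)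
    (ρ : Equiv.Perm (Fin (n + 1)))
    (_ : graft h (σ i) (Sum.inl : _ → Fin (k + 1) ⊕ Fin (l + 1)) Sum.inr ∘ ρ =
      graft h i (Sum.inl ∘ σ) (Sum.inr ∘ τ))
    hi' hc hc',
    comp h i hi (act g σ) (act f τ) hc = act (comp h (σ i) hi' g f hc') ρ
  /- `(g ∘_i f) · τ_{k+l} = (g · τ_{k+1}) ∘_{i-1} f` for `2 ≤ i ≤ k` -/
  cyclic_inner : ∀ {k l n : ℕ} (h : n + 1 = k + l) (i i' : Fin (k + 1)) (g : Op k) (f : Op l)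
    hi hi' (_ : (i : ℕ) = i' + 1) hc hc',
    act (comp h i hi g f hc) (finRotate (n + 1)) =
      comp h i' hi' (act g (finRotate (k + 1))) f hc'
  /- `(g ∘_1 f) · τ_{k+l} = (f · τ_{l+1}) ∘_l (g · τ_{k+1})` for `l ≠ 0` -/
  cyclic_outer : ∀ {k l n : ℕ} (h : n + 1 = k + l) (h' : n + 1 = l + k) (i : Fin (k + 1))
    (g : Op k) (f : Op l) hi hl (_ : (i : ℕ) = 1) (_ : l ≠ 0) hc hc',
    act (comp h i hi g f hc) (finRotate (n + 1)) =
      comp h' (Fin.last l) hl (act f (finRotate (l + 1))) (act g (finRotate (k + 1))) hc'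

namespace CycOperad

/-- A map of colored cyclic operads: a map of color sets and a map of operations that respects
colors, identities, the actions of `Σ_n⁺` and compositions. -/
@[ext]
structure Hom (P Q : CycOperad.{u}) where
  color : P.Color → Q.Color
  op : ∀ {n}, P.Op n → Q.Op n
  col_op : ∀ {n} (x : P.Op n), Q.col (op x) = color ∘ P.col x
  op_unit : ∀ a, op (P.unit a) = Q.unit (color a)
  op_act : ∀ {n} (x : P.Op n) σ, op (P.act x σ) = Q.act (op x) σ
  op_comp : ∀ {k l n : ℕ} (h : n + 1 = k + l) i hi (g : P.Op k) (f : P.Op l) hc hc',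
    op (P.comp h i hi g f hc) = Q.comp h i hi (op g) (op f) hc'

/-- The category `Cyc` of colored cyclic operads. -/
instance : Category CycOperad.{u} where
  Hom := Hom
  id P :=
    { color := id
      op := id
      col_op := fun _ => rfl
      op_unit := fun _ => rfl
      op_act := fun _ _ => rfl
      op_comp := fun _ _ _ _ _ _ _ => rfl }
  comp {P Q R} F G :=
    { color := G.color ∘ F.color
      op := fun x => G.op (F.op x)
      col_op := fun x => by rw [G.col_op, F.col_op]; rfl
      op_unit := fun a => by rw [F.op_unit, G.op_unit]; rfl
      op_act := fun x σ => by rw [F.op_act, G.op_act]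
      op_comp := fun h i hi g f hc hc' => by
        have hF : Q.col (F.op f) 0 = Q.col (F.op g) i := by
          rw [F.col_op, F.col_op, Function.comp_apply, Function.comp_apply, hc]
        rw [F.op_comp h i hi g f hc hF, G.op_comp h i hi _ _ hF hc'] }

/-! ### The free colored cyclic operad on a collection of generators -/

section Free

variable {𝔠 Gen : Type u} {ar : Gen → ℕ} (prof : ∀ v, Fin (ar v + 1) → 𝔠)

/-- Formal composites of generators `v` of profile `prof v = (c₀, …, c_{ar v})`. -/
inductive Expr : (n : ℕ) → (Fin (n + 1) → 𝔠) → Type u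
  | gen (v : Gen) : Expr (ar v) (prof v)
  | unit (a : 𝔠) : Expr 1 (fun _ => a)
  | act {n c} (x : Expr n c) (σ : Equiv.Perm (Fin (n + 1))) : Expr n (c ∘ σ)
  | comp {k l n c d} (h : n + 1 = k + l) (i : Fin (k + 1)) (hi : i ≠ 0) (g : Expr k c)
      (f : Expr l d) (hc : d 0 = c i) : Expr n (graft h i c d)

variable {prof}

/-- The smallest congruence on formal composites for which the axioms of a colored cyclic
operad hold. -/
inductive Expr.Rel : ∀ {n : ℕ} {c c' : Fin (n + 1) → 𝔠}, Expr prof n c → Expr prof n c' → Prop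
  | refl {n c} (x : Expr prof n c) : Rel x x
  | symm {n c c'} {x : Expr prof n c} {y : Expr prof n c'} : Rel x y → Rel y x
  | trans {n c c' c''} {x : Expr prof n c} {y : Expr prof n c'} {z : Expr prof n c''} :
      Rel x y → Rel y z → Rel x z
  | act_congr {n c c'} {x : Expr prof n c} {y : Expr prof n c'} (σ) :
      Rel x y → Rel (x.act σ) (y.act σ)
  | comp_congr {k l n c c' d d'} {g : Expr prof k c} {g' : Expr prof k c'} {f : Expr prof l d}
      {f' : Expr prof l d'} (h : n + 1 = k + l) (i hi hc hc') :
      Rel g g' → Rel f f' → Rel (Expr.comp h i hi g f hc) (Expr.comp h i hi g' f' hc')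
  | act_one {n c} (x : Expr prof n c) : Rel (x.act 1) x
  | act_mul {n c} (x : Expr prof n c) (σ τ) : Rel (x.act (σ * τ)) ((x.act σ).act τ)
  | comp_unit {n c} (h : n + 1 = n + 1) (i hi) (x : Expr prof n c) (a hc) :
      Rel (Expr.comp h i hi x (Expr.unit a) hc) x
  | unit_comp {n c} (h : n + 1 = 1 + n) (hi) (x : Expr prof n c) (a hc) :
      Rel (Expr.comp h 1 hi (Expr.unit a) x hc) x
  | assoc_seq {k l m a b n c d e} (x : Expr prof k c) (y : Expr prof l d) (z : Expr prof m e)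
      (i : Fin (k + 1)) (j : Fin (l + 1)) (p : Fin (a + 1)) (hi hj hp)
      (_ : (p : ℕ) + 1 = i + j)
      (ha : a + 1 = k + l) (hb : b + 1 = l + m) (hn : n + 1 = a + m) (hn' : n + 1 = k + b)
      (hxy hyz h₁ h₂) :
      Rel (Expr.comp hn p hp (Expr.comp ha i hi x y hxy) z h₁)
        (Expr.comp hn' i hi x (Expr.comp hb j hj y z hyz) h₂)
  | assoc_par {k l m a b n c d e} (x : Expr prof k c) (y : Expr prof l d) (z : Expr prof m e)
      (i j : Fin (k + 1)) (p : Fin (a + 1)) (q : Fin (b + 1)) (hi hj hp hq) (_ : i < j)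
      (_ : (p : ℕ) + 1 = j + l) (_ : (q : ℕ) = i)
      (ha : a + 1 = k + l) (hb : b + 1 = k + m) (hn : n + 1 = a + m) (hn' : n + 1 = b + l)
      (hxy hxz h₁ h₂) :
      Rel (Expr.comp hn p hp (Expr.comp ha i hi x y hxy) z h₁)
        (Expr.comp hn' q hq (Expr.comp hb j hj x z hxz) y h₂)
  | equivariance {k l n c d} (h : n + 1 = k + l) (i : Fin (k + 1)) (hi) (g : Expr prof k c)
      (f : Expr prof l d) (σ : Equiv.Perm (Fin (k + 1))) (τ : Equiv.Perm (Fin (l + 1)))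
      (_ : σ 0 = 0) (_ : τ 0 = 0) (ρ : Equiv.Perm (Fin (n + 1)))
      (_ : graft h (σ i) (Sum.inl : _ → Fin (k + 1) ⊕ Fin (l + 1)) Sum.inr ∘ ρ =
        graft h i (Sum.inl ∘ σ) (Sum.inr ∘ τ)) (hi' hc hc') :
      Rel (Expr.comp h i hi (g.act σ) (f.act τ) hc) ((Expr.comp h (σ i) hi' g f hc').act ρ)
  | cyclic_inner {k l n c d} (h : n + 1 = k + l) (i i' : Fin (k + 1)) (g : Expr prof k c)
      (f : Expr prof l d) (hi hi') (_ : (i : ℕ) = i' + 1) (hc hc') :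
      Rel ((Expr.comp h i hi g f hc).act (finRotate (n + 1)))
        (Expr.comp h i' hi' (g.act (finRotate (k + 1))) f hc')
  | cyclic_outer {k l n c d} (h : n + 1 = k + l) (h' : n + 1 = l + k) (i : Fin (k + 1))
      (g : Expr prof k c) (f : Expr prof l d) (hi hl) (_ : (i : ℕ) = 1) (_ : l ≠ 0) (hc hc') :
      Rel ((Expr.comp h i hi g f hc).act (finRotate (n + 1)))
        (Expr.comp h' (Fin.last l) hl (f.act (finRotate (l + 1)))
          (g.act (finRotate (k + 1))) hc')

theorem finRotate_val {n : ℕ} (j : Fin (n + 1)) :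
    ((finRotate (n + 1) j : Fin (n + 1)) : ℕ) = if (j : ℕ) = n then 0 else (j : ℕ) + 1 := by
  split_ifs with h
  · obtain rfl : j = Fin.last n := Fin.ext h
    simp
  · have : (j : ℕ) < n := by omega
    rw [show j = ⟨j, by omega⟩ from rfl, finRotate_of_lt this]

theorem comp_graft {α β : Type*} (f : α → β) {k l n : ℕ} (h : n + 1 = k + l) (i : Fin (k + 1))
    (c : Fin (k + 1) → α) (d : Fin (l + 1) → α) :
    f ∘ graft h i c d = graft h i (f ∘ c) (f ∘ d) := by
  funext j
  simp only [graft, Function.comp_apply]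
  split_ifs <;> rfl

theorem Expr.Rel.profile_eq {n : ℕ} {c c' : Fin (n + 1) → 𝔠} {x : Expr prof n c}
    {y : Expr prof n c'} (h : Expr.Rel x y) : c = c' := by
  induction h with
  | refl => rfl
  | symm _ ih => exact ih.symm
  | trans _ _ ih ih' => exact ih.trans ih'
  | act_congr _ _ ih => rw [ih]
  | comp_congr _ _ _ _ _ _ _ ih ih' => rw [ih, ih']
  | act_one => rfl
  | act_mul => rfl
  | @comp_unit n c h i hi x a hc =>
    funext j
    simp only [graft]
    split_ifs with h₁ h₂
    · rfl
    · rw [hc]; congr 1; ext; omega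
    · rfl
  | @unit_comp n c h hi x a hc =>
    funext j
    simp only [graft, Fin.val_one]
    split_ifs with h₁ h₂
    · rw [← hc]; congr 1; ext; simp; omega
    · congr 1; ext; simp; omega
    · omega
  | @assoc_seq k l m a b n c d e x y z i j p hi hj hp hpe ha hb hn hn' hxy hyz h₁ h₂ =>
    have hi' : (i : ℕ) ≠ 0 := fun h => hi (Fin.ext h)
    have hj' : (j : ℕ) ≠ 0 := fun h => hj (Fin.ext h)
    funext t
    simp only [graft]
    split_ifs <;> first | omega | rfl | (congr 1; ext; simp only; omega)
  | @assoc_par k l m a b n c d e x y z i j p q hi hj hp hq hij hpe hqe ha hb hn hn' hxy hxz h₁ h₂ =>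
    have hij' : (i : ℕ) < j := hij
    funext t
    simp only [graft]
    split_ifs <;> first | omega | rfl | (congr 1; ext; simp only; omega)
  | @equivariance k l n c d h i hi g f σ τ hσ hτ ρ hρ hi' hc hc' =>
    have := congrArg (fun q => Sum.elim c d ∘ q) hρ
    simp only [← Function.comp_assoc, comp_graft] at this
    exact this.symm
  | @cyclic_inner k l n c d h i i' g f hi hi' hii hc hc' =>
    have hi0 : (i' : ℕ) ≠ 0 := fun h => hi' (Fin.ext h)
    funext t
    have ht := finRotate_val t
    simp only [graft, Function.comp_apply]
    split_ifs at ht <;> split_ifs <;>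
      first
      | omega
      | (congr 1; ext; simp only [finRotate_val]; (try split_ifs) <;> omega)
  | @cyclic_outer k l n c d h h' i g f hi hl hi1 hl0 hc hc' =>
    funext t
    have ht := finRotate_val t
    simp only [graft, Function.comp_apply, Fin.val_last]
    split_ifs at ht <;> split_ifs <;>
      first
      | omega
      | (congr 1; ext; simp only [finRotate_val]; (try split_ifs) <;> omega)

variable (prof)

/-- Formal composites of given arity (and any profile), up to the congruence `Expr.Rel`. -/
def exprSetoid (n : ℕ) : Setoid (Σ c, Expr prof n c) where
  r x y := Expr.Rel x.2 y.2
  iseqv := ⟨fun x => .refl x.2, fun h => .symm h, fun h h' => .trans h h'⟩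

/-- The operations of the free colored cyclic operad. -/
def FreeOp (n : ℕ) : Type u := Quotient (exprSetoid prof n)

namespace FreeOp

variable {prof}

/-- The operation given by a formal composite. -/
def mk {n c} (x : Expr prof n c) : FreeOp prof n := Quotient.mk (exprSetoid prof n) ⟨c, x⟩

theorem sound {n c c'} {x : Expr prof n c} {y : Expr prof n c'} (h : Expr.Rel x y) :
    mk x = mk y := Quotient.sound (s := exprSetoid prof n) h

theorem ind {n} {p : FreeOp prof n → Prop} (h : ∀ c (x : Expr prof n c), p (mk x)) (X) : p X :=
  Quotient.ind (s := exprSetoid prof n) (fun x => h x.1 x.2) X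

/-- The profile of an operation. -/
def col {n} : FreeOp prof n → Fin (n + 1) → 𝔠 :=
  Quotient.lift (s := exprSetoid prof n) (fun x => x.1) (fun _ _ h => Expr.Rel.profile_eq h)

/-- The right action of `Σ_n⁺`. -/
def act {n} (X : FreeOp prof n) (σ : Equiv.Perm (Fin (n + 1))) : FreeOp prof n :=
  Quotient.lift (s := exprSetoid prof n) (fun x => mk (x.2.act σ))
    (fun _ _ h => sound (.act_congr σ h)) X

theorem exists_rep {n} (X : FreeOp prof n) : ∃ x : Expr prof n X.col, mk x = X := by
  induction X using ind with
  | h c x => exact ⟨x, rfl⟩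

/-- Partial composition, by composing representatives. -/
noncomputable def comp {k l n : ℕ} (h : n + 1 = k + l) (i : Fin (k + 1)) (hi : i ≠ 0)
    (g : FreeOp prof k) (f : FreeOp prof l) (hc : f.col 0 = g.col i) : FreeOp prof n :=
  mk (Expr.comp h i hi g.exists_rep.choose f.exists_rep.choose hc)

theorem comp_mk {k l n : ℕ} {c d} (h : n + 1 = k + l) (i : Fin (k + 1)) (hi : i ≠ 0)
    (g : Expr prof k c) (f : Expr prof l d) (hc : (mk f).col 0 = (mk g).col i) :
    comp h i hi (mk g) (mk f) hc = mk (Expr.comp h i hi g f hc) :=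
  sound (.comp_congr h i hi hc hc
    (Quotient.exact (s := exprSetoid prof k) (mk g).exists_rep.choose_spec)
    (Quotient.exact (s := exprSetoid prof l) (mk f).exists_rep.choose_spec))

theorem act_mk {n c} (x : Expr prof n c) (σ) : act (mk x) σ = mk (x.act σ) := rfl

end FreeOp

/-- The free colored cyclic operad with color set `𝔠` on generators `v ∈ Gen` of arity `ar v` and
profile `prof v = (c₀, …, c_{ar v})`: formal composites of the generators modulo the axioms. -/
noncomputable abbrev free : CycOperad.{u} where
  Color := 𝔠
  Op := FreeOp prof
  col := FreeOp.col
  unit a := FreeOp.mk (.unit a)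
  act := FreeOp.act
  comp := FreeOp.comp
  col_unit _ := rfl
  col_act X σ := by
    induction X using FreeOp.ind with | h c x => rfl
  col_comp h i hi g f hc := by
    induction g using FreeOp.ind with | h c g => ?_
    induction f using FreeOp.ind with | h d f => ?_
    rw [FreeOp.comp_mk]; rfl
  act_one X := by
    induction X using FreeOp.ind with | h c x => exact FreeOp.sound (.act_one x)
  act_mul X σ τ := by
    induction X using FreeOp.ind with | h c x => exact FreeOp.sound (.act_mul x σ τ)
  comp_unit h i hi X a hc := by
    induction X using FreeOp.ind with | h c x => ?_
    rw [FreeOp.comp_mk]; exact FreeOp.sound (.comp_unit h i hi x a hc)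
  unit_comp h hi X a hc := by
    induction X using FreeOp.ind with | h c x => ?_
    rw [FreeOp.comp_mk]; exact FreeOp.sound (.unit_comp h hi x a hc)
  assoc_seq X Y Z i j p hi hj hp hpe ha hb hn hn' hxy hyz h₁ h₂ := by
    induction X using FreeOp.ind with | h c x => ?_
    induction Y using FreeOp.ind with | h d y => ?_
    induction Z using FreeOp.ind with | h e z => ?_
    simp only [FreeOp.comp_mk] at h₁ h₂ ⊢
    exact FreeOp.sound (.assoc_seq x y z i j p hi hj hp hpe ha hb hn hn' hxy hyz h₁ h₂)
  assoc_par X Y Z i j p q hi hj hp hq hij hpe hqe ha hb hn hn' hxy hxz h₁ h₂ := by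
    induction X using FreeOp.ind with | h c x => ?_
    induction Y using FreeOp.ind with | h d y => ?_
    induction Z using FreeOp.ind with | h e z => ?_
    simp only [FreeOp.comp_mk] at h₁ h₂ ⊢
    exact FreeOp.sound
      (.assoc_par x y z i j p q hi hj hp hq hij hpe hqe ha hb hn hn' hxy hxz h₁ h₂)
  equivariance h i hi g f σ τ hσ hτ ρ hρ hi' hc hc' := by
    induction g using FreeOp.ind with | h c g => ?_
    induction f using FreeOp.ind with | h d f => ?_
    simp only [FreeOp.comp_mk, FreeOp.act_mk] at hc ⊢
    exact FreeOp.sound (.equivariance h i hi g f σ τ hσ hτ ρ hρ hi' hc hc')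
  cyclic_inner h i i' g f hi hi' hii hc hc' := by
    induction g using FreeOp.ind with | h c g => ?_
    induction f using FreeOp.ind with | h d f => ?_
    simp only [FreeOp.comp_mk, FreeOp.act_mk] at hc' ⊢
    exact FreeOp.sound (.cyclic_inner h i i' g f hi hi' hii hc hc')
  cyclic_outer h h' i g f hi hl hi1 hl0 hc hc' := by
    induction g using FreeOp.ind with | h c g => ?_
    induction f using FreeOp.ind with | h d f => ?_
    simp only [FreeOp.comp_mk, FreeOp.act_mk] at hc' ⊢
    exact FreeOp.sound (.cyclic_outer h h' i g f hi hl hi1 hl0 hc hc')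

end Free

/-- `P` is free on the family of operations `gen v ∈ P.Op (ar v)`: for every colored cyclic operad
`Q`, every map `f` from the colors of `P` to those of `Q`, and every choice of operations
`q v` of `Q` whose profiles are the images under `f` of those of `gen v`, there is a
unique map `P ⟶ Q` that is `f` on colors and sends `gen v` to `q v`. -/
def IsFreeOn (P : CycOperad.{u}) {Gen : Type u} {ar : Gen → ℕ} (gen : ∀ v, P.Op (ar v)) : Prop :=
  ∀ (Q : CycOperad.{u}) (f : P.Color → Q.Color) (q : ∀ v, Q.Op (ar v)),
    (∀ v, Q.col (q v) = f ∘ P.col (gen v)) →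
    ∃! F : Hom P Q, F.color = f ∧ ∀ v, F.op (gen v) = q v

end CycOperad

/-! ## The functor from unrooted trees to colored cyclic operads -/

namespace UTree

/-- The cyclic operad `C(S)`: the free colored cyclic operad with color set the set of edges of `S`,
on one generator `v` for each vertex, with profile the ordered list `nbhd v`. -/
noncomputable abbrev cycOperad (S : UTree.{u}) : CycOperad.{u} :=
  CycOperad.free (𝔠 := S.Edge) (Gen := S.Vert) (ar := S.ar) fun v j => (S.ordV v j : S.Edge)

/-- The generator of `C(S)` given by a vertex `v`. -/
def gen (S : UTree.{u}) (v : S.Vert) : S.cycOperad.Op (S.ar v) := CycOperad.FreeOp.mk (.gen v)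

/-- `Represents T x` says that `x` is the operation of `C(S)` determined by the subgraph `T` of `S`,
with legs ordered by the profile `col x`. That is, `x` is the composite of the generators given
by the vertices of `T`, composed along the interior edges of `T`: a single edge `|_e` gives the
identity of `e`, a single vertex `v` gives the generator `v`, reordering the legs corresponds to
the action of `Σ_n⁺`, and if `T` is the union of two subgraphs with intersection
`|_e` then the operation of `T` is the composite of theirs along `e`. -/
inductive Represents {S : UTree.{u}} : ∀ {n : ℕ}, S.Subgraph → S.cycOperad.Op n → Prop
  | edge (e : S.Edge) : Represents (Subgraph.edge e) (S.cycOperad.unit e)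
  | star (v : S.Vert) : Represents (Subgraph.star v) (S.gen v)
  | act {n : ℕ} {T : S.Subgraph} {x : S.cycOperad.Op n} (σ : Equiv.Perm (Fin (n + 1))) :
      Represents T x → Represents T (S.cycOperad.act x σ)
  | comp {k l n : ℕ} {T T' U : S.Subgraph} {x : S.cycOperad.Op k} {y : S.cycOperad.Op l}
      (h : n + 1 = k + l) (i : Fin (k + 1)) (hi : i ≠ 0)
      (hc : S.cycOperad.col y 0 = S.cycOperad.col x i) :
      Represents T x → Represents T' y →
      (Subgraph.edge (S.cycOperad.col x i)).IsInter T T' → U.IsUnion T T' →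
      Represents U (S.cycOperad.comp h i hi x y hc)

/-- `F : C(R) ⟶ C(S)` is the map `C(φ)` induced by a morphism `φ` of trees: on colors it is the map
on edges, and it sends the generator of a vertex `v` to the operation determined by the subgraph
`φ₁(v)` of `S`, with its legs ordered by `φ₀ ∘ ord^v` (this is the profile of `F v`). -/
def IsInduced {R S : UTree.{u}} (φ : R ⟶ S) (F : R.cycOperad ⟶ S.cycOperad) : Prop :=
  (CycOperad.Hom.color F : R.Edge → S.Edge) = Hom.onEdge φ ∧
    ∀ v : R.Vert, Represents (Hom.onSub φ (Subgraph.star v)) (CycOperad.Hom.op F (R.gen v))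

/-- `C` is the functor which sends a tree `S` to `C(S)` and a morphism `φ` to the induced map. -/
def IsCycFunctor (C : UTree.{u} ⥤ CycOperad.{u}) : Prop :=
  ∃ hobj : ∀ S, C.obj S = S.cycOperad, ∀ {R S : UTree.{u}} (φ : R ⟶ S),
    IsInduced φ (eqToHom (hobj R).symm ≫ C.map φ ≫ eqToHom (hobj S))

end UTree

/-!
The heart of the matter is that the operation of `C(S)` determined by a subgraph `T` with ordered
legs is well defined (`Represents.unique`). Operations are considered up to reordering of their
legs (`Orb`). The equivariance and cyclicity axioms show that gluing two such orbits along a color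
is well defined and symmetric as long as colors identify legs (`SymmGlue.unique`), and the two
associativity axioms combine into a single associativity law (`SymmGlue.assoc`). Suppose that `T`
is glued from `A` and `B` along `f`, and also from `T₁` and `T₂` along `e ≠ f`. The one of `T₁`,
`T₂` that does not contain `f` is connected, so lies in `A` or in `B`; if `T₂` lies in `A`, then
`A` splits along `e` into `T₁ ∩ A` and `T₂`, and associativity shows that an operation composed
along `f` is also a composite along `e`. So by induction an operation of `T` decomposes along any
splitting of `T` (`IsComposite.split`), and uniqueness follows by induction on `T`.

Conversely every subgraph is built from an edge by attaching vertices one at a time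
(`Subgraph.induction_star`), so it determines an operation for each ordering of its legs
(`Represents.exists_of_boundary`). As `C(R)` is free, a morphism of trees `φ` induces exactly one
map, and since `φ` preserves intersections and unions, this map sends the operation of any subgraph
`T` to that of `φ₁(T)` (`IsInduced.represents`). Functoriality and uniqueness of the functor
follow.

The congruence defining a free cyclic operad preserves the multiset of generators of a formal
composite, so an operation determines the vertices of any subgraph it represents
(`Represents.gens`). Hence `C(φ)` determines `φ₁` on stars, therefore on all subgraphs, and `C` is
faithful. It is not full since a map of cyclic operads may send a vertex to an operation in which
some vertex occurs twice (`exists_forall_not_isInduced`).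
-/

/-! ### Grafted labellings -/

/-- Two injective labellings of a finite set by the same labels differ by a permutation. -/
theorem exists_perm_comp_eq {ι α : Type*} [Finite ι] {f g : ι → α} (hf : Function.Injective f)
    (hfg : ∀ j, f j ∈ Set.range g) : ∃ σ : Equiv.Perm ι, g ∘ σ = f := by
  choose σ hσ using hfg
  have hσi : Function.Injective σ := fun a b hab => hf (by rw [← hσ, ← hσ, hab])
  exact ⟨Equiv.ofBijective σ (Finite.injective_iff_bijective.mp hσi), funext hσ⟩

section Graft

variable {α : Type*} {k l n : ℕ} {h : n + 1 = k + l} {i : Fin (k + 1)}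
  {c : Fin (k + 1) → α} {d : Fin (l + 1) → α} {j : Fin (n + 1)}

theorem graft_of_lt {u : Fin (k + 1)} (hu : (u : ℕ) < i) (hj : (j : ℕ) = u) :
    graft h i c d j = c u := by
  simp only [graft]
  rw [dif_pos (by omega)]
  congr 1; ext; simpa using hj

theorem graft_zero (hi : i ≠ 0) : graft h i c d 0 = c 0 :=
  graft_of_lt (Nat.pos_of_ne_zero fun h => hi (Fin.ext h)) rfl

theorem graft_of_gt {u : Fin (k + 1)} (hu : (i : ℕ) < u) (hj : (j : ℕ) + 1 = u + l) :
    graft h i c d j = c u := by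
  simp only [graft]
  rw [dif_neg (by omega), dif_neg (by omega)]
  congr 1; ext; simp only; omega

theorem graft_right {w : Fin (l + 1)} (hw : w ≠ 0) (hj : (j : ℕ) + 1 = i + w) :
    graft h i c d j = d w := by
  have hw' : (w : ℕ) ≠ 0 := fun h => hw (Fin.ext h)
  simp only [graft]
  rw [dif_neg (by omega), dif_pos (by omega)]
  congr 1; ext; simp only; omega

variable (h i c d)

theorem range_graft : Set.range (graft h i c d) = c '' {i}ᶜ ∪ d '' {0}ᶜ := by
  ext a
  constructor
  · rintro ⟨j, rfl⟩
    simp only [graft]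
    split_ifs with h₁ h₂
    · exact Or.inl ⟨_, by
        simp only [Set.mem_compl_iff, Set.mem_singleton_iff, Fin.ext_iff]; omega, rfl⟩
    · exact Or.inr ⟨_, by simp [Fin.ext_iff], rfl⟩
    · exact Or.inl ⟨_, by
        simp only [Set.mem_compl_iff, Set.mem_singleton_iff, Fin.ext_iff]; omega, rfl⟩
  · rintro (⟨u, hu, rfl⟩ | ⟨w, hw, rfl⟩)
    · have hu' : (u : ℕ) ≠ i := fun h => hu (Fin.ext h)
      rcases lt_or_gt_of_ne hu' with hlt | hgt
      · exact ⟨⟨u, by omega⟩, graft_of_lt hlt rfl⟩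
      · exact ⟨⟨u + l - 1, by omega⟩, graft_of_gt hgt (by simp only; omega)⟩
    · have hw' : (w : ℕ) ≠ 0 := fun h => hw (Fin.ext h)
      exact ⟨⟨i + w - 1, by omega⟩, graft_right hw (by simp only; omega)⟩

theorem graft_injective (hc : Function.Injective c) (hd : Function.Injective d)
    (hcd : ∀ u w, u ≠ i → w ≠ 0 → c u ≠ d w) : Function.Injective (graft h i c d) := by
  intro j j' hjj
  have key : ∀ (u : Fin (k + 1)) (w : Fin (l + 1)), (u : ℕ) ≠ i → (w : ℕ) ≠ 0 → c u ≠ d w :=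
    fun u w hu hw => hcd u w (fun e => hu (congrArg _ e)) (fun e => hw (congrArg _ e))
  simp only [graft] at hjj
  split_ifs at hjj <;>
    first
    | (have := hc hjj; simp only [Fin.mk.injEq] at this; ext; omega)
    | (have := hd hjj; simp only [Fin.mk.injEq] at this; ext; omega)
    | exact absurd hjj (key _ _ (by simp only; omega) (by simp only; omega))
    | exact absurd hjj.symm (key _ _ (by simp only; omega) (by simp only; omega))

/-- The block permutation `σ ∘_i τ` occurring in the equivariance axiom exists. -/
theorem exists_block_perm (σ : Equiv.Perm (Fin (k + 1))) (τ : Equiv.Perm (Fin (l + 1)))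
    (hτ : τ 0 = 0) : ∃ ρ : Equiv.Perm (Fin (n + 1)),
      graft h (σ i) (Sum.inl : _ → Fin (k + 1) ⊕ Fin (l + 1)) Sum.inr ∘ ρ =
        graft h i (Sum.inl ∘ σ) (Sum.inr ∘ τ) := by
  have hinj : Function.Injective
      (graft h i (Sum.inl ∘ σ : _ → Fin (k + 1) ⊕ Fin (l + 1)) (Sum.inr ∘ τ)) :=
    graft_injective h i _ _ (Sum.inl_injective.comp σ.injective)
      (Sum.inr_injective.comp τ.injective) (by simp)
  have hex : ∀ j, graft h i (Sum.inl ∘ σ) (Sum.inr ∘ τ) j ∈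
      Set.range (graft h (σ i) (Sum.inl : _ → Fin (k + 1) ⊕ Fin (l + 1)) Sum.inr) := by
    intro j
    have hj : graft h i (Sum.inl ∘ σ : _ → Fin (k + 1) ⊕ Fin (l + 1)) (Sum.inr ∘ τ) j ∈
        Set.range _ := Set.mem_range_self j
    rw [range_graft] at hj
    rw [range_graft]
    rcases hj with ⟨u, hu, e⟩ | ⟨w, hw, e⟩
    · exact Or.inl ⟨σ u, by simpa using hu, e⟩
    · refine Or.inr ⟨τ w, fun hw' => hw ?_, e⟩
      exact τ.injective (Eq.trans hw' hτ.symm)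
  exact exists_perm_comp_eq hinj hex

end Graft

theorem finRotate_pow_val {k : ℕ} (m : ℕ) (j : Fin (k + 1)) (hj : (j : ℕ) + m ≤ k) :
    (((finRotate (k + 1) ^ m) j : Fin (k + 1)) : ℕ) = j + m := by
  induction m with
  | zero => rfl
  | succ m ih =>
    rw [pow_succ', Equiv.Perm.mul_apply, CycOperad.finRotate_val, ih (by omega), if_neg (by omega)]
    rfl

theorem fin_val_two {k : ℕ} : ((2 : Fin (k + 2 + 1)) : ℕ) = 2 :=
  Nat.mod_eq_of_lt (show 2 < k + 2 + 1 by omega)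

theorem exists_perm_apply_eq_pair {β : Type*} [DecidableEq β] {i j u w : β} (hij : i ≠ j)
    (huw : u ≠ w) : ∃ σ : Equiv.Perm β, σ i = u ∧ σ j = w := by
  refine ⟨Equiv.swap (Equiv.swap i u j) w * Equiv.swap i u, ?_, ?_⟩
  · rw [Equiv.Perm.mul_apply, Equiv.swap_apply_left]
    refine Equiv.swap_apply_of_ne_of_ne (fun e => hij ?_) huw
    have := congrArg (Equiv.swap i u) e
    simpa using this
  · simp

namespace CycOperad

variable {P : CycOperad.{u}}

theorem comp_congr {k l n : ℕ} {h : n + 1 = k + l} {i i' : Fin (k + 1)} {hi hi'} {x x' : P.Op k}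
    {y y' : P.Op l} {hc hc'} (hx : x = x') (hii : i = i') (hy : y = y') :
    P.comp h i hi x y hc = P.comp h i' hi' x' y' hc' := by
  subst hx hii hy; rfl

/-- Identities are invariant under exchanging their two legs; this follows from the cyclic
symmetry of composition by composing with an identity. -/
theorem act_unit (a : P.Color) (σ : Equiv.Perm (Fin 2)) : P.act (P.unit a) σ = P.unit a := by
  have hσ : ∀ σ : Equiv.Perm (Fin 2), σ = 1 ∨ σ = finRotate 2 := by decide
  rcases hσ σ with rfl | rfl
  · exact P.act_one _
  · have hcol : ∀ σ j, P.col (P.act (P.unit a) σ) j = a := fun σ j => by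
      rw [P.col_act, P.col_unit]; rfl
    have hcol' : ∀ j, P.col (P.unit a) j = a := fun j => by rw [P.col_unit]
    have hrot : P.act (P.act (P.unit a) (finRotate 2)⁻¹) (finRotate 2) = P.unit a := by
      rw [← P.act_mul, inv_mul_cancel, P.act_one]
    have key := P.cyclic_outer (k := 1) (l := 1) (n := 1) rfl rfl 1 (P.unit a)
      (P.act (P.unit a) (finRotate 2)⁻¹) (by decide) (by decide) rfl one_ne_zero
      (by rw [hcol, hcol']) (by rw [hrot, hcol, hcol'])
    rw [P.unit_comp] at key
    have key' := key.symm.trans hrot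
    rw [comp_congr (hi' := by decide) (hc' := by rw [hcol, hcol']) hrot
        (show Fin.last 1 = 1 from rfl) rfl, P.unit_comp] at key'
    exact key'

/-! ### Operations up to reordering of their legs -/

variable (P) in
/-- Two operations, of a priori different arities, are equivalent if they differ by a
reordering of the legs. -/
def orbitSetoid : Setoid (Σ n, P.Op n) where
  r x y := ∃ σ, (⟨x.1, P.act x.2 σ⟩ : Σ n, P.Op n) = y
  iseqv := by
    refine ⟨fun x => ⟨1, by rw [P.act_one]⟩, ?_, ?_⟩
    · rintro ⟨n, x⟩ _ ⟨σ, rfl⟩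
      exact ⟨σ⁻¹, by simp only [← P.act_mul, mul_inv_cancel, P.act_one]⟩
    · rintro ⟨n, x⟩ _ _ ⟨σ, rfl⟩ ⟨τ, rfl⟩
      exact ⟨σ * τ, by simp only [P.act_mul]⟩

variable (P) in
/-- The operations of `P` of all arities, up to reordering of their legs. -/
def Orb : Type u := Quotient P.orbitSetoid

/-- The class of an operation up to reordering of its legs. -/
def orb {n : ℕ} (x : P.Op n) : P.Orb := Quotient.mk P.orbitSetoid ⟨n, x⟩

theorem orb_act {n : ℕ} (x : P.Op n) (σ) : orb (P.act x σ) = orb x :=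
  (Quotient.sound (s := P.orbitSetoid) ⟨σ, rfl⟩ : orb x = orb (P.act x σ)).symm

theorem exists_act_eq_of_orb_eq {n : ℕ} {x y : P.Op n} (h : orb x = orb y) :
    ∃ σ, P.act x σ = y := by
  obtain ⟨σ, h⟩ := Quotient.exact (s := P.orbitSetoid) h
  exact ⟨σ, eq_of_heq (Sigma.mk.inj_iff.mp h).2⟩

namespace Orb

theorem exists_rep (X : P.Orb) : ∃ (n : ℕ) (x : P.Op n), orb x = X := by
  obtain ⟨⟨n, x⟩, rfl⟩ := Quotient.exists_rep X
  exact ⟨n, x, rfl⟩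

/-- The common arity of the operations in an orbit. -/
def arity : P.Orb → ℕ :=
  Quotient.lift (s := P.orbitSetoid) (fun x => x.1) (by rintro ⟨n, x⟩ _ ⟨σ, rfl⟩; rfl)

/-- The set of the colors of the legs. -/
def colors : P.Orb → Set P.Color :=
  Quotient.lift (s := P.orbitSetoid) (fun x => Set.range (P.col x.2)) (by
    rintro ⟨n, x⟩ _ ⟨σ, rfl⟩
    simp only [P.col_act]
    exact (σ.surjective.range_comp _).symm)

/-- The legs have distinct colors, so that a leg may be named by its color. -/
def DistinctColors : P.Orb → Prop :=
  Quotient.lift (s := P.orbitSetoid) (fun x => Function.Injective (P.col x.2)) (by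
    rintro ⟨n, x⟩ _ ⟨σ, rfl⟩
    simp only [P.col_act, eq_iff_iff]
    exact (Equiv.injective_comp σ _).symm)

theorem exists_rep_of_arity_ne_zero {X : P.Orb} {e : P.Color} (he : e ∈ X.colors)
    (hX : X.arity ≠ 0) : ∃ (k : ℕ) (x : P.Op (k + 1)), orb x = X ∧ P.col x 1 = e := by
  obtain ⟨n, x, rfl⟩ := X.exists_rep
  obtain ⟨k, rfl⟩ := Nat.exists_eq_succ_of_ne_zero hX
  obtain ⟨j, rfl⟩ := he
  exact ⟨k, P.act x (Equiv.swap 1 j), orb_act _ _, by simp [P.col_act]⟩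

theorem exists_rep_zero {X : P.Orb} {e : P.Color} (he : e ∈ X.colors) :
    ∃ (k : ℕ) (x : P.Op k), orb x = X ∧ P.col x 0 = e := by
  obtain ⟨n, x, rfl⟩ := X.exists_rep
  obtain ⟨j, rfl⟩ := he
  exact ⟨n, P.act x (Equiv.swap 0 j), orb_act _ _, by simp [P.col_act]⟩

theorem exists_rep_zero_one {X : P.Orb} {e f : P.Color} (he : e ∈ X.colors) (hf : f ∈ X.colors)
    (hef : e ≠ f) : ∃ (k : ℕ) (x : P.Op (k + 1)), orb x = X ∧ P.col x 0 = e ∧ P.col x 1 = f := by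
  obtain ⟨n, x, rfl⟩ := X.exists_rep
  obtain ⟨(j : Fin (n + 1)), rfl⟩ := he
  obtain ⟨(j' : Fin (n + 1)), rfl⟩ := hf
  have hjj : j ≠ j' := fun h => hef (congrArg (P.col x) h)
  obtain ⟨k, rfl⟩ : ∃ k, n = k + 1 := Nat.exists_eq_succ_of_ne_zero fun h => by
    subst h; exact hjj (Fin.ext (by omega))
  obtain ⟨σ, h0, h1⟩ := exists_perm_apply_eq_pair (zero_ne_one (α := Fin (k + 1 + 1))) hjj
  exact ⟨k, P.act x σ, orb_act _ _, by simp [P.col_act, h0], by simp [P.col_act, h1]⟩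

theorem exists_rep_one_two {X : P.Orb} {e f : P.Color} (he : e ∈ X.colors) (hf : f ∈ X.colors)
    (hef : e ≠ f) (hX : 2 ≤ X.arity) :
    ∃ (k : ℕ) (x : P.Op (k + 2)), orb x = X ∧ P.col x 1 = e ∧ P.col x 2 = f := by
  obtain ⟨n, x, rfl⟩ := X.exists_rep
  obtain ⟨k, rfl⟩ : ∃ k, n = k + 2 := ⟨n - 2, by change 2 ≤ n at hX; omega⟩
  obtain ⟨j, rfl⟩ := he
  obtain ⟨j', rfl⟩ := hf
  have hjj : j ≠ j' := fun h => hef (congrArg (P.col x) h)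
  have h12 : (1 : Fin (k + 2 + 1)) ≠ 2 := by rw [Ne, Fin.ext_iff, fin_val_two]; simp
  obtain ⟨σ, h0, h1⟩ := exists_perm_apply_eq_pair h12 hjj
  exact ⟨k, P.act x σ, orb_act _ _, by simp [P.col_act, h0], by simp [P.col_act, h1]⟩

end Orb

theorem arity_eq_of_orb_eq {n m : ℕ} {x : P.Op n} {y : P.Op m} (h : orb x = orb y) : n = m :=
  congrArg Orb.arity h

theorem eq_unit_of_orb_eq {a : P.Color} {x : P.Op 1} (h : orb x = orb (P.unit a)) :
    x = P.unit a := by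
  obtain ⟨σ, rfl⟩ := exists_act_eq_of_orb_eq h.symm
  exact act_unit a σ

theorem orb_comp_of_left_eq_unit {k l n : ℕ} (h : n + 1 = k + l) (i : Fin (k + 1)) (hi)
    (x : P.Op k) (y : P.Op l) (hc) {a : P.Color} (hx : orb x = orb (P.unit a)) :
    orb (P.comp h i hi x y hc) = orb y := by
  obtain rfl := arity_eq_of_orb_eq hx
  obtain rfl := eq_unit_of_orb_eq hx
  obtain rfl : i = 1 := Fin.eq_one_of_ne_zero i hi
  obtain rfl : n = l := by omega
  rw [P.unit_comp]

theorem orb_comp_of_right_eq_unit {k l n : ℕ} (h : n + 1 = k + l) (i : Fin (k + 1)) (hi)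
    (x : P.Op k) (y : P.Op l) (hc) {a : P.Color} (hy : orb y = orb (P.unit a)) :
    orb (P.comp h i hi x y hc) = orb x := by
  obtain rfl := arity_eq_of_orb_eq hy
  obtain rfl := eq_unit_of_orb_eq hy
  obtain rfl : n = k := by omega
  rw [P.comp_unit]

/-! ### Composition does not depend on the order of the legs -/

theorem orb_comp_act_of_apply_zero {k l n : ℕ} (h : n + 1 = k + l) {i i' : Fin (k + 1)}
    (hi hi') (x : P.Op k) (y : P.Op l) (σ τ) (hc hc') (hσ : σ i' = i) (hσ0 : σ 0 = 0)
    (hτ0 : τ 0 = 0) :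
    orb (P.comp h i' hi' (P.act x σ) (P.act y τ) hc') = orb (P.comp h i hi x y hc) := by
  subst hσ
  obtain ⟨ρ, hρ⟩ := exists_block_perm h i' σ τ hτ0
  rw [P.equivariance h i' hi' x y σ τ hσ0 hτ0 ρ hρ hi hc' hc, orb_act]

theorem orb_comp_act_finRotate_pow {k l n : ℕ} (h : n + 1 = k + l) (m : ℕ) {i i' : Fin (k + 1)}
    (hi hi') (x : P.Op k) (y : P.Op l) (hc hc') (him : (i : ℕ) = i' + m) :
    orb (P.comp h i' hi' (P.act x (finRotate (k + 1) ^ m)) y hc') =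
      orb (P.comp h i hi x y hc) := by
  induction m generalizing i i' with
  | zero =>
    congr 1
    exact comp_congr (by rw [pow_zero, P.act_one]) (Fin.ext (by omega)) rfl
  | succ m ih =>
    have hlt : (i' : ℕ) + 1 < k + 1 := by omega
    have hrot : finRotate (k + 1) i' = ⟨i' + 1, hlt⟩ := by
      ext; rw [finRotate_val, if_neg (by omega)]
    have hact : P.act x (finRotate (k + 1) ^ (m + 1)) =
        P.act (P.act x (finRotate (k + 1) ^ m)) (finRotate (k + 1)) := by
      rw [pow_succ, P.act_mul]
    have hc₁ : P.col y 0 = P.col (P.act x (finRotate (k + 1) ^ m)) ⟨i' + 1, hlt⟩ := by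
      rw [hc', hact, P.col_act, Function.comp_apply, hrot]
    have hne : (⟨i' + 1, hlt⟩ : Fin (k + 1)) ≠ 0 := fun h => Nat.succ_ne_zero _ (congrArg Fin.val h)
    rw [comp_congr (hi' := hi') (hc' := by rw [← hact]; exact hc') hact rfl rfl,
      ← P.cyclic_inner h ⟨i' + 1, hlt⟩ i' _ y hne hi' rfl hc₁, orb_act]
    exact ih hi hne hc hc₁ (by simp only; omega)

/-- Composing along given legs of `x` and `y` does not depend on the orders of the legs, as
long as the leg of `x` is an input and that of `y` is the output. -/
theorem orb_comp_act {k l n : ℕ} (h : n + 1 = k + l) {i i' : Fin (k + 1)}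
    (hi hi') (x : P.Op k) (y : P.Op l) (σ τ) (hc hc') (hσ : σ i' = i) (hτ0 : τ 0 = 0) :
    orb (P.comp h i' hi' (P.act x σ) (P.act y τ) hc') = orb (P.comp h i hi x y hc) := by
  set r := finRotate (k + 1) with hr
  have hi0 : (i : ℕ) ≠ 0 := fun h => hi (Fin.ext h)
  have hne : ((σ 0 : Fin (k + 1)) : ℕ) ≠ i := fun h => hi' (σ.injective (by
    rw [hσ]; exact Fin.ext h.symm))
  have hcy : ∀ τ, τ 0 = 0 → P.col (P.act y τ) 0 = P.col y 0 := fun τ hτ => by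
    rw [P.col_act, Function.comp_apply, hτ]
  rcases lt_or_gt_of_ne hne with hlt | hgt
  -- rotate leg `σ 0` of `x` down to position `0`
  · obtain ⟨m, hm⟩ : ∃ m : ℕ, ((σ 0 : Fin (k + 1)) : ℕ) = m := ⟨_, rfl⟩
    have hr0 : (r ^ m) 0 = σ 0 := Fin.ext (by
      rw [finRotate_pow_val m 0 (by simp; omega), hm]; simp)
    have hri : (r ^ m) ⟨i - m, by omega⟩ = i := Fin.ext (by
      rw [finRotate_pow_val m _ (by simp only; omega)]; simp only; omega)
    have hx : P.act x σ = P.act (P.act x (r ^ m)) ((r ^ m)⁻¹ * σ) := by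
      rw [← P.act_mul, mul_inv_cancel_left]
    have hcx : P.col y 0 = P.col (P.act x (r ^ m)) ⟨i - m, by omega⟩ := by
      rw [hc, P.col_act, Function.comp_apply, hri]
    have hne' : (⟨i - m, by omega⟩ : Fin (k + 1)) ≠ 0 := by simp [Fin.ext_iff]; omega
    rw [comp_congr (hi' := hi') (hc' := by rw [← hx]; exact hc') hx rfl rfl,
      orb_comp_act_of_apply_zero h hne' hi' _ y _ τ hcx _
        (by rw [Equiv.Perm.mul_apply, hσ, Equiv.Perm.inv_eq_iff_eq, hri])
        (by rw [Equiv.Perm.mul_apply, Equiv.Perm.inv_eq_iff_eq, hr0]) hτ0]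
    exact orb_comp_act_finRotate_pow h m hi hne' x y hc hcx (by simp only; omega)
  -- rotate leg `σ 0` of `x` up, past the last position, to position `0`
  · obtain ⟨s, hs⟩ : ∃ s : ℕ, ((σ 0 : Fin (k + 1)) : ℕ) + s = k :=
      ⟨k - (σ 0 : Fin (k + 1)), by omega⟩
    have hr0 : (r ^ (s + 1)) (σ 0) = 0 := Fin.ext (by
      rw [pow_succ', Equiv.Perm.mul_apply, finRotate_val, finRotate_pow_val s _ (by omega),
        if_pos hs]; rfl)
    have hlt : (i : ℕ) + (s + 1) < k + 1 := by omega
    have hri : (r ^ (s + 1)) i = ⟨i + (s + 1), hlt⟩ := Fin.ext (by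
      rw [finRotate_pow_val (s + 1) _ (by omega)])
    have hx : P.act x σ = P.act (P.act x (r ^ (s + 1))⁻¹) (r ^ (s + 1) * σ) := by
      rw [← P.act_mul, inv_mul_cancel_left]
    have hx' : x = P.act (P.act x (r ^ (s + 1))⁻¹) (r ^ (s + 1)) := by
      rw [← P.act_mul, inv_mul_cancel, P.act_one]
    have hcx : P.col y 0 = P.col (P.act x (r ^ (s + 1))⁻¹) ⟨i + (s + 1), hlt⟩ := by
      rw [hc, P.col_act, Function.comp_apply, ← hri, ← Equiv.Perm.mul_apply, inv_mul_cancel,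
        Equiv.Perm.one_apply]
    have hne' : (⟨i + (s + 1), hlt⟩ : Fin (k + 1)) ≠ 0 :=
      fun h => Nat.succ_ne_zero _ (congrArg Fin.val h)
    rw [comp_congr (hi' := hi') (hc' := by rw [← hx]; exact hc') hx rfl rfl,
      orb_comp_act_of_apply_zero h hne' hi' _ y _ τ hcx _
        (by rw [Equiv.Perm.mul_apply, hσ, hri])
        (by rw [Equiv.Perm.mul_apply, hr0]) hτ0,
      ← orb_comp_act_finRotate_pow h (s + 1) hne' hi _ y hcx (by rw [← hx']; exact hc) rfl]
    congr 1
    exact comp_congr hx'.symm rfl rfl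

/-- `Glue e X Y Z`: the orbit `Z` contains the composite of a member of `X` and a member of `Y`
along an input of the former and the output of the latter, both of color `e`. -/
def Glue (e : P.Color) (X Y Z : P.Orb) : Prop :=
  ∃ (k l n : ℕ) (h : n + 1 = k + l) (i : Fin (k + 1)) (hi : i ≠ 0) (x : P.Op k) (y : P.Op l)
    (hc : P.col y 0 = P.col x i), orb x = X ∧ orb y = Y ∧ orb (P.comp h i hi x y hc) = Z ∧
      P.col x i = e

namespace Glue

variable {e : P.Color} {X Y Z Z' : P.Orb}

theorem left_arity (h : Glue e X Y Z) : X.arity ≠ 0 := by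
  obtain ⟨k, l, n, h, i, hi, x, y, hc, rfl, rfl, rfl, rfl⟩ := h
  rintro (rfl : k = 0)
  exact hi (Fin.ext (by omega))

theorem arity_add_one (h : Glue e X Y Z) : Z.arity + 1 = X.arity + Y.arity := by
  obtain ⟨k, l, n, h, i, hi, x, y, hc, rfl, rfl, rfl, rfl⟩ := h
  exact h

theorem mem_left (h : Glue e X Y Z) : e ∈ X.colors := by
  obtain ⟨k, l, n, h, i, hi, x, y, hc, rfl, rfl, rfl, rfl⟩ := h
  exact ⟨i, rfl⟩

theorem mem_right (h : Glue e X Y Z) : e ∈ Y.colors := by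
  obtain ⟨k, l, n, h, i, hi, x, y, hc, rfl, rfl, rfl, rfl⟩ := h
  exact ⟨0, hc⟩

theorem unique (hX : X.DistinctColors) (hY : Y.DistinctColors) (h : Glue e X Y Z)
    (h' : Glue e X Y Z') : Z = Z' := by
  obtain ⟨k, l, n, h, i, hi, x, y, hc, rfl, rfl, rfl, he⟩ := h
  obtain ⟨k', l', n', h', i', hi', x', y', hc', hx, hy, rfl, he'⟩ := h'
  obtain rfl := arity_eq_of_orb_eq hx
  obtain rfl := arity_eq_of_orb_eq hy
  obtain rfl : n = n' := by omega
  obtain ⟨σ, rfl⟩ := exists_act_eq_of_orb_eq hx.symm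
  obtain ⟨τ, rfl⟩ := exists_act_eq_of_orb_eq hy.symm
  symm
  refine orb_comp_act h hi hi' x y σ τ hc hc' (hX ?_) (hY ?_)
  · rw [he, ← he', P.col_act]; rfl
  · rw [hc, he, ← he', ← hc', P.col_act]; rfl

theorem symm (h : Glue e X Y Z) (hY : Y.arity ≠ 0) : Glue e Y X Z := by
  obtain ⟨k, l, n, h, i, hi, x, y, hc, rfl, rfl, rfl, rfl⟩ := h
  have hl : l ≠ 0 := hY
  obtain ⟨k, rfl⟩ := Nat.exists_eq_succ_of_ne_zero fun hk : k = 0 => by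
    subst hk; exact hi (Fin.ext (by omega))
  have hcx : P.col y 0 = P.col (P.act x (Equiv.swap 1 i)) 1 := by simp [P.col_act, hc]
  have h0l : finRotate (l + 1) (Fin.last l) = 0 := by simp
  have h01 : finRotate (k + 1 + 1) 0 = 1 := by simp
  have hlast : Fin.last l ≠ 0 := by simpa [Fin.ext_iff] using hl
  have hcc : P.col (P.act (P.act x (Equiv.swap 1 i)) (finRotate (k + 1 + 1))) 0 =
      P.col (P.act y (finRotate (l + 1))) (Fin.last l) := by
    rw [P.col_act, P.col_act y, Function.comp_apply, Function.comp_apply, h0l, h01, hcx]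
  refine ⟨l, k + 1, n, by omega, Fin.last l, hlast, P.act y (finRotate (l + 1)),
    P.act (P.act x (Equiv.swap 1 i)) (finRotate (k + 1 + 1)), hcc,
    orb_act _ _, by rw [orb_act, orb_act], ?_, ?_⟩
  · rw [← P.cyclic_outer h (by omega) 1 _ _ one_ne_zero hlast (by simp) hl hcx, orb_act]
    rw [← orb_comp_act h hi one_ne_zero x y (Equiv.swap 1 i) 1 hc
      (by rw [P.act_one]; exact hcx) (by simp) rfl]
    congr 1
    exact comp_congr rfl rfl (P.act_one y).symm
  · rw [P.col_act, Function.comp_apply, h0l, hc]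

end Glue

theorem Glue.distinctColors_and_colors_eq {e : P.Color} {X Y Z : P.Orb} (hX : X.DistinctColors)
    (hY : Y.DistinctColors) (hXY : X.colors ∩ Y.colors ⊆ {e}) (h : Glue e X Y Z) :
    Z.DistinctColors ∧ Z.colors = X.colors \ {e} ∪ Y.colors \ {e} := by
  obtain ⟨k, l, n, h, i, hi, x, y, hc, rfl, rfl, rfl, rfl⟩ := h
  have hX' : Function.Injective (P.col x) := hX
  have hY' : Function.Injective (P.col y) := hY
  constructor
  · change Function.Injective (P.col (P.comp h i hi x y hc))
    rw [P.col_comp]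
    refine graft_injective h i _ _ hX' hY' fun u w hu _ huw => hu (hX' ?_)
    exact hXY ⟨⟨u, rfl⟩, ⟨w, huw.symm⟩⟩
  · change Set.range (P.col (P.comp h i hi x y hc)) = _
    rw [P.col_comp, range_graft, Set.image_compl_eq_range_sdiff_image hX',
      Set.image_compl_eq_range_sdiff_image hY', Set.image_singleton, Set.image_singleton, hc]
    rfl

/-- The symmetric version of `Glue`, which does not record which of the two operations has
the output among its legs. -/
def SymmGlue (e : P.Color) (X Y Z : P.Orb) : Prop := Glue e X Y Z ∨ Glue e Y X Z

namespace SymmGlue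

variable {e f : P.Color} {X Y Z Z' A W : P.Orb}

theorem symm (h : SymmGlue e X Y Z) : SymmGlue e Y X Z := Or.symm h

theorem glue (h : SymmGlue e X Y Z) (hX : X.arity ≠ 0) : Glue e X Y Z :=
  h.elim id fun h => h.symm hX

theorem arity_add_one (h : SymmGlue e X Y Z) : Z.arity + 1 = X.arity + Y.arity :=
  h.elim Glue.arity_add_one fun h => by rw [h.arity_add_one, add_comm]

theorem mem_left (h : SymmGlue e X Y Z) : e ∈ X.colors := h.elim Glue.mem_left Glue.mem_right

theorem mem_right (h : SymmGlue e X Y Z) : e ∈ Y.colors := h.symm.mem_left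

theorem distinctColors_and_colors_eq (hX : X.DistinctColors) (hY : Y.DistinctColors)
    (hXY : X.colors ∩ Y.colors ⊆ {e}) (h : SymmGlue e X Y Z) :
    Z.DistinctColors ∧ Z.colors = X.colors \ {e} ∪ Y.colors \ {e} := by
  rcases h with h | h
  · exact h.distinctColors_and_colors_eq hX hY hXY
  · rw [Set.union_comm]
    exact h.distinctColors_and_colors_eq hY hX (by rwa [Set.inter_comm])

theorem unique (hX : X.DistinctColors) (hY : Y.DistinctColors) (h : SymmGlue e X Y Z)
    (h' : SymmGlue e X Y Z') : Z = Z' := by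
  rcases h with h | h
  · exact h.unique hX hY (h'.glue h.left_arity)
  · exact h.unique hY hX (h'.symm.glue h.left_arity)

/-- Associativity: if `A` is `X` with `Y` glued on along `e`, and `W` is `A` with `Z` glued on along
a leg `f` of `X`, then the two gluings may be performed in the other order. -/
theorem assoc (hX : X.DistinctColors) (hY : Y.DistinctColors) (hZ : Z.DistinctColors)
    (hA : A.DistinctColors) (h : SymmGlue e X Y A) (h' : SymmGlue f A Z W) (hf : f ∈ X.colors)
    (hef : e ≠ f) : ∃ C, SymmGlue f X Z C ∧ SymmGlue e C Y W := by
  by_cases hZ0 : Z.arity ≠ 0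
  -- `z ∘ (x ∘ y) = (z ∘ x) ∘ y`, where `f` is the output of `x`
  · obtain ⟨k, x, rfl, hx0, hx1⟩ := Orb.exists_rep_zero_one hf h.mem_left hef.symm
    obtain ⟨l, y, rfl, hy⟩ := Orb.exists_rep_zero h.mem_right
    obtain ⟨m, z, rfl, hz⟩ := Orb.exists_rep_of_arity_ne_zero h'.mem_right hZ0
    have hxy : k + l + 1 = (k + 1) + l := by omega
    have hzx : m + (k + 1) + 1 = (m + 1) + (k + 1) := by omega
    have cxy : P.col y 0 = P.col x 1 := by rw [hy, hx1]
    have czx : P.col x 0 = P.col z 1 := by rw [hx0, hz]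
    have gA : Glue e (orb x) (orb y) (orb (P.comp hxy 1 one_ne_zero x y cxy)) :=
      ⟨_, _, _, hxy, 1, one_ne_zero, x, y, cxy, rfl, rfl, rfl, hx1⟩
    obtain rfl := h.unique hX hY (Or.inl gA)
    have c₂ : P.col (P.comp hxy 1 one_ne_zero x y cxy) 0 = P.col z 1 := by
      rw [P.col_comp, graft_zero one_ne_zero, czx]
    have c₁ : P.col y 0 = P.col (P.comp hzx 1 one_ne_zero z x czx) 1 := by
      rw [P.col_comp, graft_right (w := 1) one_ne_zero (by simp), cxy]
    have hW : m + (k + l) + 1 = (m + 1) + (k + l) := by omega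
    have hW' : m + (k + l) + 1 = (m + (k + 1)) + l := by omega
    have gW : Glue f (orb z) (orb (P.comp hxy 1 one_ne_zero x y cxy))
        (orb (P.comp hW 1 one_ne_zero z _ c₂)) :=
      ⟨_, _, _, hW, 1, one_ne_zero, z, _, c₂, rfl, rfl, rfl, hz⟩
    obtain rfl := h'.unique hA hZ (Or.inr gW)
    refine ⟨orb (P.comp hzx 1 one_ne_zero z x czx), Or.inr ?_, Or.inl ?_⟩
    · exact ⟨_, _, _, hzx, 1, one_ne_zero, z, x, czx, rfl, rfl, rfl, hz⟩
    · refine ⟨_, _, _, hW', 1, one_ne_zero, _, y, c₁, rfl, rfl, ?_, by rw [← c₁, hy]⟩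
      rw [P.assoc_seq z x y 1 1 1 one_ne_zero one_ne_zero one_ne_zero (by simp)
        hzx hxy hW' hW czx cxy c₁ c₂]
  by_cases hY0 : Y.arity ≠ 0
  -- `(y ∘ x) ∘ z = y ∘ (x ∘ z)`, where `e` is the output of `x`
  · obtain ⟨k, x, rfl, hx0, hx1⟩ := Orb.exists_rep_zero_one h.mem_left hf hef
    obtain ⟨m, z, rfl, hz⟩ := Orb.exists_rep_zero h'.mem_right
    obtain ⟨l, y, rfl, hy⟩ := Orb.exists_rep_of_arity_ne_zero h.mem_right hY0
    have hxz : k + m + 1 = (k + 1) + m := by omega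
    have hyx : l + (k + 1) + 1 = (l + 1) + (k + 1) := by omega
    have cxz : P.col z 0 = P.col x 1 := by rw [hz, hx1]
    have cyx : P.col x 0 = P.col y 1 := by rw [hx0, hy]
    have gA : Glue e (orb y) (orb x) (orb (P.comp hyx 1 one_ne_zero y x cyx)) :=
      ⟨_, _, _, hyx, 1, one_ne_zero, y, x, cyx, rfl, rfl, rfl, hy⟩
    obtain rfl := h.unique hX hY (Or.inr gA)
    have c₂ : P.col (P.comp hxz 1 one_ne_zero x z cxz) 0 = P.col y 1 := by
      rw [P.col_comp, graft_zero one_ne_zero, cyx]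
    have c₁ : P.col z 0 = P.col (P.comp hyx 1 one_ne_zero y x cyx) 1 := by
      rw [P.col_comp, graft_right (w := 1) one_ne_zero (by simp), cxz]
    have hW : l + (k + m) + 1 = (l + 1) + (k + m) := by omega
    have hW' : l + (k + m) + 1 = (l + (k + 1)) + m := by omega
    have gW : Glue f (orb (P.comp hyx 1 one_ne_zero y x cyx)) (orb z)
        (orb (P.comp hW' 1 one_ne_zero _ z c₁)) :=
      ⟨_, _, _, hW', 1, one_ne_zero, _, z, c₁, rfl, rfl, rfl, by rw [← c₁, hz]⟩
    obtain rfl := h'.unique hA hZ (Or.inl gW)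
    refine ⟨orb (P.comp hxz 1 one_ne_zero x z cxz), Or.inl ?_, Or.inr ?_⟩
    · exact ⟨_, _, _, hxz, 1, one_ne_zero, x, z, cxz, rfl, rfl, rfl, hx1⟩
    · refine ⟨_, _, _, hW, 1, one_ne_zero, y, _, c₂, rfl, rfl, ?_, hy⟩
      rw [P.assoc_seq y x z 1 1 1 one_ne_zero one_ne_zero one_ne_zero (by simp)
        hyx hxz hW' hW cyx cxz c₁ c₂]
  -- if neither `y` nor `z` has an input, then `x` has at least two inputs
  · have hX2 : 2 ≤ X.arity := by
      have hA0 : A.arity ≠ 0 := h'.elim Glue.left_arity fun g => absurd g.left_arity hZ0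
      have := h.arity_add_one
      omega
    obtain ⟨k, x, rfl, hx1, hx2⟩ := Orb.exists_rep_one_two h.mem_left hf hef hX2
    obtain ⟨l, y, rfl, hy⟩ := Orb.exists_rep_zero h.mem_right
    obtain ⟨m, z, rfl, hz⟩ := Orb.exists_rep_zero h'.mem_right
    have v1 : ((1 : Fin (k + 2 + 1)) : ℕ) = 1 := by simp
    have v2 : ((2 : Fin (k + 2 + 1)) : ℕ) = 2 := fin_val_two
    have n2 : (2 : Fin (k + 2 + 1)) ≠ 0 := by rw [Ne, Fin.ext_iff, v2]; simp
    have hxy : (k + 1 + l) + 1 = (k + 2) + l := by omega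
    have hxz : (k + 1 + m) + 1 = (k + 2) + m := by omega
    have cxy : P.col y 0 = P.col x 1 := by rw [hy, hx1]
    have cxz : P.col z 0 = P.col x 2 := by rw [hz, hx2]
    obtain ⟨p, hp⟩ : ∃ p : Fin (k + 1 + l + 1), (p : ℕ) = 1 + l := ⟨⟨1 + l, by omega⟩, rfl⟩
    obtain ⟨q, hq⟩ : ∃ q : Fin (k + 1 + m + 1), (q : ℕ) = 1 := ⟨⟨1, by omega⟩, rfl⟩
    have hp0 : p ≠ 0 := by simp [Fin.ext_iff, hp]
    have hq0 : q ≠ 0 := by simp [Fin.ext_iff, hq]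
    have gA : Glue e (orb x) (orb y) (orb (P.comp hxy 1 one_ne_zero x y cxy)) :=
      ⟨_, _, _, hxy, 1, one_ne_zero, x, y, cxy, rfl, rfl, rfl, hx1⟩
    obtain rfl := h.unique hX hY (Or.inl gA)
    have c₁ : P.col z 0 = P.col (P.comp hxy 1 one_ne_zero x y cxy) p := by
      rw [P.col_comp, graft_of_gt (u := 2) (by omega) (by omega), cxz]
    have c₂ : P.col y 0 = P.col (P.comp hxz 2 n2 x z cxz) q := by
      rw [P.col_comp, graft_of_lt (u := 1) (by omega) (by omega), cxy]
    have hW : (k + l + m) + 1 = (k + 1 + l) + m := by omega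
    have hW' : (k + l + m) + 1 = (k + 1 + m) + l := by omega
    have gW : Glue f (orb (P.comp hxy 1 one_ne_zero x y cxy)) (orb z)
        (orb (P.comp hW p hp0 _ z c₁)) :=
      ⟨_, _, _, hW, p, hp0, _, z, c₁, rfl, rfl, rfl, by rw [← c₁, hz]⟩
    obtain rfl := h'.unique hA hZ (Or.inl gW)
    refine ⟨orb (P.comp hxz 2 n2 x z cxz), Or.inl ?_, Or.inl ?_⟩
    · exact ⟨_, _, _, hxz, 2, n2, x, z, cxz, rfl, rfl, rfl, hx2⟩
    · refine ⟨_, _, _, hW', q, hq0, _, y, c₂, rfl, rfl, ?_, by rw [← c₂, hy]⟩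
      rw [P.assoc_par x y z 1 2 p q one_ne_zero n2 hp0 hq0 (by rw [Fin.lt_def]; omega) (by omega)
        (by omega) hxy hxz hW hW' cxy cxz c₁ c₂]

end SymmGlue

end CycOperad

namespace UTree

variable {S : UTree.{u}}

/-! ### Subgraphs of a tree -/

theorem incidence_adj_inl_inr {v : S.Vert} {e : S.Edge} :
    S.incidence.Adj (Sum.inl v) (Sum.inr e) ↔ e ∈ S.nbhd v := by
  simp [LegGraph.incidence]

theorem incidence_adj_inl_inl {v w : S.Vert} : ¬ S.incidence.Adj (Sum.inl v) (Sum.inl w) := by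
  simp [LegGraph.incidence]

theorem incidence_adj_inr_inr {e f : S.Edge} : ¬ S.incidence.Adj (Sum.inr e) (Sum.inr f) := by
  simp [LegGraph.incidence]

/-- A property of vertices and edges that is invariant under incidence is invariant under
adjacency of nodes. -/
theorem sum_elim_iff_of_adj {V : Set S.Vert} {P : S.Vert → Prop} {Q : S.Edge → Prop}
    (hPQ : ∀ v ∈ V, ∀ e ∈ S.nbhd v, (P v ↔ Q e)) {a b : S.Vert ⊕ S.Edge}
    (ha : ∀ v, a = Sum.inl v → v ∈ V) (hb : ∀ v, b = Sum.inl v → v ∈ V)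
    (hab : S.incidence.Adj a b) : Sum.elim P Q a ↔ Sum.elim P Q b := by
  rcases a with v | e <;> rcases b with w | f
  · exact absurd hab incidence_adj_inl_inl
  · exact hPQ v (ha v rfl) f (incidence_adj_inl_inr.mp hab)
  · exact (hPQ w (hb w rfl) e (incidence_adj_inl_inr.mp hab.symm)).symm
  · exact absurd hab incidence_adj_inr_inr

theorem _root_.SimpleGraph.Reachable.iff_of_adj {V : Type*} {G : SimpleGraph V} {F : V → Prop}
    (hF : ∀ a b, G.Adj a b → (F a ↔ F b)) {a b : V} (h : G.Reachable a b) : F a ↔ F b := by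
  obtain ⟨p⟩ := h
  induction p with
  | nil => rfl
  | cons hadj _ ih => exact (hF _ _ hadj).trans ih

theorem exists_mem_nbhd (v : S.Vert) : ∃ e, e ∈ S.nbhd v := ⟨S.ordV v 0, (S.ordV v 0).2⟩

theorem eq_of_mem_nbhd_of_mem_nbhd_of_mem_nbhd {e : S.Edge} {a b c : S.Vert} (ha : e ∈ S.nbhd a)
    (hb : e ∈ S.nbhd b) (hc : e ∈ S.nbhd c) (hac : a ≠ c) (hbc : b ≠ c) : a = b := by
  by_contra hab
  have h3 : ({a, b, c} : Set S.Vert).encard = 3 :=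
    Set.encard_eq_three.mpr ⟨a, b, c, hab, hac, hbc, rfl⟩
  have hsub : ({a, b, c} : Set S.Vert) ⊆ {v | e ∈ S.nbhd v} := by
    rintro x (rfl | rfl | rfl) <;> assumption
  have := (Set.encard_le_encard hsub).trans (S.incident_le_two e)
  rw [h3] at this
  exact absurd this (by decide)

namespace Subgraph

/-- The vertices and the edges of a subgraph, as nodes of the incidence graph. -/
def nodes (T : S.Subgraph) : Set (S.Vert ⊕ S.Edge) := Sum.inl '' T.verts ∪ Sum.inr '' T.edges

@[simp]
theorem inl_mem_nodes {T : S.Subgraph} {v : S.Vert} : Sum.inl v ∈ T.nodes ↔ v ∈ T.verts := by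
  simp [nodes]

@[simp]
theorem inr_mem_nodes {T : S.Subgraph} {e : S.Edge} : Sum.inr e ∈ T.nodes ↔ e ∈ T.edges := by
  simp [nodes]

/-- Connectedness of a subgraph: a property invariant under incidence holds everywhere or
nowhere. -/
theorem forall_or_forall_not (T : S.Subgraph) {P : S.Vert → Prop} {Q : S.Edge → Prop}
    (hPQ : ∀ v ∈ T.verts, ∀ e ∈ S.nbhd v, (P v ↔ Q e)) :
    ((∀ v ∈ T.verts, P v) ∧ ∀ e ∈ T.edges, Q e) ∨
      ((∀ v ∈ T.verts, ¬ P v) ∧ ∀ e ∈ T.edges, ¬ Q e) := by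
  have key : ∀ a ∈ T.nodes, ∀ b ∈ T.nodes, (Sum.elim P Q a ↔ Sum.elim P Q b) := by
    intro a ha b hb
    have hr : (S.incidence.induce T.nodes).Reachable ⟨a, ha⟩ ⟨b, hb⟩ :=
      T.contractible.connected.preconnected _ _
    exact hr.iff_of_adj (F := fun x => Sum.elim P Q x.1) fun x y hxy =>
      sum_elim_iff_of_adj (V := T.verts) hPQ (fun v hv => inl_mem_nodes.mp (hv ▸ x.2))
        (fun v hv => inl_mem_nodes.mp (hv ▸ y.2)) hxy
  by_cases h : ∃ a ∈ T.nodes, Sum.elim P Q a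
  · obtain ⟨a, ha, hPa⟩ := h
    exact Or.inl ⟨fun v hv => (key a ha (Sum.inl v) (by simpa)).mp hPa,
      fun e he => (key a ha (Sum.inr e) (by simpa)).mp hPa⟩
  · push Not at h
    exact Or.inr ⟨fun v hv => h (Sum.inl v) (by simpa), fun e he => h (Sum.inr e) (by simpa)⟩

theorem edges_nonempty (T : S.Subgraph) : T.edges.Nonempty := by
  obtain ⟨⟨x, hx⟩⟩ := T.contractible.connected.nonempty
  rcases hx with ⟨v, hv, rfl⟩ | ⟨e, he, rfl⟩
  · obtain ⟨e, he⟩ := exists_mem_nbhd v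
    exact ⟨e, T.nbhd_subset v hv he⟩
  · exact ⟨e, he⟩

theorem exists_incident {T : S.Subgraph} (hT : T.verts.Nonempty) {e : S.Edge} (he : e ∈ T.edges) :
    ∃ v ∈ T.verts, e ∈ S.nbhd v := by
  by_contra! h
  rcases T.forall_or_forall_not (P := fun _ => False) (Q := fun f => f = e)
    (fun v hv f hf => ⟨False.elim, fun hfe => h v hv (hfe ▸ hf)⟩) with ⟨h', -⟩ | ⟨-, h'⟩
  · exact h' _ hT.choose_spec
  · exact h' e he rfl

theorem eq_edge_of_verts_eq_empty {T : S.Subgraph} (hT : T.verts = ∅) {e : S.Edge}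
    (he : e ∈ T.edges) : T = edge e := by
  rcases T.forall_or_forall_not (P := fun _ => False) (Q := fun f => f = e)
    (by simp [hT]) with ⟨-, h'⟩ | ⟨-, h'⟩
  · refine Subgraph.ext hT (Set.Subset.antisymm h' ?_)
    rintro _ rfl
    exact he
  · exact absurd rfl (h' e he)

theorem exists_eq_edge {T : S.Subgraph} (hT : T.verts = ∅) : ∃ e, T = edge e :=
  ⟨_, eq_edge_of_verts_eq_empty hT T.edges_nonempty.choose_spec⟩

theorem edges_eq_of_nonempty {T : S.Subgraph} (hT : T.verts.Nonempty) :
    T.edges = ⋃ v ∈ T.verts, S.nbhd v := by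
  refine Set.Subset.antisymm (fun e he => ?_) (Set.iUnion₂_subset T.nbhd_subset)
  obtain ⟨v, hv, hev⟩ := exists_incident hT he
  exact Set.mem_iUnion₂.mpr ⟨v, hv, hev⟩

theorem ext_verts {T T' : S.Subgraph} (hT : T.verts.Nonempty) (h : T.verts = T'.verts) :
    T = T' := by
  refine Subgraph.ext h ?_
  rw [edges_eq_of_nonempty hT, edges_eq_of_nonempty (h ▸ hT), h]

theorem edge_injective {e f : S.Edge} (h : edge e = edge f) : e = f :=
  Set.singleton_injective (congrArg Subgraph.edges h)

theorem exists_isUnion {T T' : S.Subgraph} {e : S.Edge} (he : e ∈ T.edges) (he' : e ∈ T'.edges) :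
    ∃ U : S.Subgraph, U.IsUnion T T' := by
  refine ⟨⟨T.verts ∪ T'.verts, T.edges ∪ T'.edges, ?_, ?_, S.contractible.isAcyclic.induce _⟩,
    rfl, rfl⟩
  · rintro v (hv | hv)
    · exact (T.nbhd_subset v hv).trans Set.subset_union_left
    · exact (T'.nbhd_subset v hv).trans Set.subset_union_right
  · have h : (Sum.inl '' (T.verts ∪ T'.verts) ∪ Sum.inr '' (T.edges ∪ T'.edges) :
        Set (S.Vert ⊕ S.Edge)) = T.nodes ∪ T'.nodes := by
      rw [Set.image_union, Set.image_union, Set.union_union_union_comm]; rfl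
    rw [h]
    exact SimpleGraph.induce_union_connected T.contractible.connected.preconnected
      T'.contractible.connected.preconnected ⟨Sum.inr e, by simpa, by simpa⟩

/-- The intersection of overlapping subgraphs is connected since paths in a tree are unique. -/
theorem exists_isInter {T T' : S.Subgraph} {e : S.Edge} (he : e ∈ T.edges) (he' : e ∈ T'.edges) :
    ∃ I : S.Subgraph, I.IsInter T T' := by
  refine ⟨⟨T.verts ∩ T'.verts, T.edges ∩ T'.edges, ?_, ?_, S.contractible.isAcyclic.induce _⟩,
    rfl, rfl⟩
  · exact fun v hv => Set.subset_inter (T.nbhd_subset v hv.1) (T'.nbhd_subset v hv.2)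
  · have h : (Sum.inl '' (T.verts ∩ T'.verts) ∪ Sum.inr '' (T.edges ∩ T'.edges) :
        Set (S.Vert ⊕ S.Edge)) = T.nodes ∩ T'.nodes := by
      ext (v | f) <;> simp
    rw [h]
    have : Nonempty ↑(T.nodes ∩ T'.nodes) := ⟨⟨Sum.inr e, by simpa, by simpa⟩⟩
    refine ⟨?_⟩
    classical
    rintro ⟨a, ha, ha'⟩ ⟨b, hb, hb'⟩
    have path : ∀ s : Set (S.Vert ⊕ S.Edge), (S.incidence.induce s).Preconnected →
        a ∈ s → b ∈ s → ∃ p : S.incidence.Walk a b, p.IsPath ∧ ∀ x ∈ p.support, x ∈ s := by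
      intro s hs ha hb
      obtain ⟨q⟩ := hs ⟨a, ha⟩ ⟨b, hb⟩
      have hq := SimpleGraph.Walk.support_map (SimpleGraph.Embedding.induce s).toHom q.toPath.1
      refine ⟨_, q.toPath.2.map (f := (SimpleGraph.Embedding.induce s).toHom)
        Subtype.val_injective, fun x hx => ?_⟩
      obtain ⟨y, -, rfl⟩ := List.mem_map.mp ((congrArg (x ∈ ·) hq).mp hx)
      exact y.2
    obtain ⟨p, hpp, hp⟩ := path T.nodes T.contractible.connected.preconnected ha hb
    obtain ⟨p', hpp', hp'⟩ := path T'.nodes T'.contractible.connected.preconnected ha' hb'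
    obtain rfl : p = p' := congrArg Subtype.val
      ((S.contractible.isAcyclic.subsingleton_path a b).elim ⟨p, hpp⟩ ⟨p', hpp'⟩)
    exact (p.induce (T.nodes ∩ T'.nodes) fun x hx => ⟨hp x hx, hp' x hx⟩).reachable

theorem IsInter.symm {I T T' : S.Subgraph} (h : I.IsInter T T') : I.IsInter T' T :=
  ⟨h.1.trans (Set.inter_comm _ _), h.2.trans (Set.inter_comm _ _)⟩

theorem IsUnion.symm {U T T' : S.Subgraph} (h : U.IsUnion T T') : U.IsUnion T' T :=
  ⟨h.1.trans (Set.union_comm _ _), h.2.trans (Set.union_comm _ _)⟩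

theorem IsUnion.unique {U U' T T' : S.Subgraph} (h : U.IsUnion T T') (h' : U'.IsUnion T T') :
    U = U' := Subgraph.ext (h.1.trans h'.1.symm) (h.2.trans h'.2.symm)

section EdgeInter

variable {A B U : S.Subgraph} {f : S.Edge}

theorem IsInter.mem_left (h : (edge f).IsInter A B) : f ∈ A.edges :=
  (h.2.subset (Set.mem_singleton f)).1

theorem IsInter.mem_right (h : (edge f).IsInter A B) : f ∈ B.edges :=
  (h.2.subset (Set.mem_singleton f)).2

theorem IsInter.eq_of_mem (h : (edge f).IsInter A B) {e : S.Edge} (ha : e ∈ A.edges)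
    (hb : e ∈ B.edges) : e = f := h.2.symm.subset ⟨ha, hb⟩

theorem IsInter.notMem (h : (edge f).IsInter A B) {v : S.Vert} (ha : v ∈ A.verts) :
    v ∉ B.verts := fun hb => (h.1.symm.subset ⟨ha, hb⟩ : v ∈ (∅ : Set S.Vert))

theorem IsInter.overlap (h : (edge f).IsInter A B) : A.Overlap B :=
  Or.inr ⟨f, h.mem_left, h.mem_right⟩

/-- Gluing a single edge onto a subgraph does not change it. -/
theorem IsUnion.eq_of_left_verts_eq_empty (hU : U.IsUnion A B) (h : (edge f).IsInter A B)
    (hA : A.verts = ∅) : A = edge f ∧ U = B := by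
  obtain rfl := eq_edge_of_verts_eq_empty hA h.mem_left
  refine ⟨rfl, Subgraph.ext ?_ ?_⟩
  · rw [hU.1, hA, Set.empty_union]
  · rw [hU.2, Set.union_eq_right]
    rintro _ rfl
    exact h.mem_right

/-- Where two subgraphs with vertices are glued, the edge is not a leg of the union. -/
theorem legs_union (hA : A.verts.Nonempty) (hB : B.verts.Nonempty) (h : (edge f).IsInter A B)
    (hU : U.IsUnion A B) : U.legs = A.legs \ {f} ∪ B.legs \ {f} := by
  have key : ∀ {A B : S.Subgraph}, A.verts.Nonempty → B.verts.Nonempty → (edge f).IsInter A B →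
      U.IsUnion A B → ∀ e ∈ A.edges, (e ∈ U.legs ↔ e ∈ A.legs \ {f}) := by
    intro A B hA hB h hU e he
    constructor
    · rintro ⟨heU, hleg⟩
      refine ⟨⟨he, fun ⟨v, hv, w, hw, hvw⟩ =>
        hleg ⟨v, hU.1 ▸ Or.inl hv, w, hU.1 ▸ Or.inl hw, hvw⟩⟩, ?_⟩
      rintro rfl
      obtain ⟨v, hv, hev⟩ := exists_incident hA he
      obtain ⟨w, hw, hew⟩ := exists_incident hB h.mem_right
      exact hleg ⟨v, hU.1 ▸ Or.inl hv, w, hU.1 ▸ Or.inr hw,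
        fun hvw => h.notMem hv (hvw ▸ hw), hev, hew⟩
    · rintro ⟨⟨-, hleg⟩, hef⟩
      have hmem : ∀ v ∈ U.verts, e ∈ S.nbhd v → v ∈ A.verts := by
        intro v hv hev
        rw [hU.1] at hv
        refine hv.resolve_right fun hvB => hef ?_
        exact h.eq_of_mem he (B.nbhd_subset v hvB hev)
      refine ⟨hU.2 ▸ Or.inl he, ?_⟩
      rintro ⟨v, hv, w, hw, hvw, hev, hew⟩
      exact hleg ⟨v, hmem v hv hev, w, hmem w hw hew, hvw, hev, hew⟩
  ext e
  constructor
  · intro he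
    have heU : e ∈ U.edges := he.1
    rw [hU.2] at heU
    rcases heU with heA | heB
    · exact Or.inl ((key hA hB h hU e heA).mp he)
    · exact Or.inr ((key hB hA h.symm hU.symm e heB).mp he)
  · rintro (he | he)
    · exact (key hA hB h hU e he.1.1).mpr he
    · exact (key hB hA h.symm hU.symm e he.1.1).mpr he

/-- A connected part of `A ∪ B` that does not pass through `f` lies on one side of `f`. -/
theorem verts_edges_subset_or (h : (edge f).IsInter A B) {T : S.Subgraph}
    (hv : T.verts ⊆ A.verts ∪ B.verts) (he : T.edges ⊆ A.edges ∪ B.edges)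
    (hf : ∀ v ∈ T.verts, ∀ w ∈ T.verts, f ∈ S.nbhd v → f ∈ S.nbhd w → v = w) :
    (T.verts ⊆ A.verts ∧ T.edges ⊆ A.edges) ∨ (T.verts ⊆ B.verts ∧ T.edges ⊆ B.edges) := by
  have key : ∀ {A B : S.Subgraph}, (edge f).IsInter A B → T.verts ⊆ A.verts ∪ B.verts →
      T.edges ⊆ A.edges ∪ B.edges → (∀ v ∈ T.verts, f ∈ S.nbhd v → v ∈ A.verts) →
      (T.verts ⊆ A.verts ∧ T.edges ⊆ A.edges) ∨ (T.verts ⊆ B.verts ∧ T.edges ⊆ B.edges) := by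
    intro A B h hv he hf
    rcases T.forall_or_forall_not (P := (· ∈ A.verts)) (Q := (· ∈ A.edges)) (by
      refine fun v hvT e hev => ⟨fun hvA => A.nbhd_subset v hvA hev, fun heA => ?_⟩
      refine (hv hvT).elim id fun hvB => hf v hvT ?_
      rwa [← h.eq_of_mem heA (B.nbhd_subset v hvB hev)]) with h' | h'
    · exact Or.inl h'
    · exact Or.inr ⟨fun v hvT => (hv hvT).resolve_left (h'.1 v hvT),
        fun e heT => (he heT).resolve_left (h'.2 e heT)⟩
  by_cases hA : ∀ v ∈ T.verts, f ∈ S.nbhd v → v ∈ A.verts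
  · exact key h hv he hA
  · push Not at hA
    obtain ⟨v, hvT, hfv, hvA⟩ := hA
    refine (key h.symm (by rwa [Set.union_comm]) (by rwa [Set.union_comm]) ?_).symm
    intro w hw hfw
    rw [hf w hw v hvT hfw hfv]
    exact (hv hvT).resolve_left hvA

end EdgeInter

/-- A proper part `T'` of a subgraph `T` can be enlarged by a vertex adjacent to it. -/
theorem exists_incident_of_subset {T T' : S.Subgraph} (hv : T'.verts ⊆ T.verts)
    (hne : T' ≠ T) (he : T'.edges ⊆ T.edges) :
    ∃ e ∈ T'.edges, ∃ w ∈ T.verts, w ∉ T'.verts ∧ e ∈ S.nbhd w := by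
  by_contra! h
  rcases T.forall_or_forall_not (P := (· ∈ T'.verts)) (Q := (· ∈ T'.edges))
    (fun v hvT e hev => ⟨fun hvT' => T'.nbhd_subset v hvT' hev,
      fun heT' => by_contra fun hvT' => h e heT' v hvT hvT' hev⟩) with h' | h'
  · exact hne (Subgraph.ext (hv.antisymm h'.1) (he.antisymm h'.2))
  · obtain ⟨e, heT'⟩ := T'.edges_nonempty
    exact h'.2 e (he heT') heT'

theorem isInter_star {T : S.Subgraph} {w : S.Vert} {e : S.Edge} (hw : w ∉ T.verts)
    (he : e ∈ T.edges) (hew : e ∈ S.nbhd w) : (edge e).IsInter T (star w) := by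
  obtain ⟨I, hI⟩ := exists_isInter (T := T) (T' := star w) he hew
  have hIv : I.verts = ∅ := by
    rw [hI.1, Set.eq_empty_iff_forall_notMem]
    rintro _ ⟨hv, rfl⟩
    exact hw hv
  rwa [← eq_edge_of_verts_eq_empty hIv (e := e) (by rw [hI.2]; exact ⟨he, hew⟩)]

/-- Every subgraph arises from an edge by successively attaching vertices. -/
theorem induction_star {P : S.Subgraph → Prop} (h_edge : ∀ e, P (edge e))
    (h_union : ∀ (T U : S.Subgraph) (w : S.Vert) (e : S.Edge), P T →
      (edge e).IsInter T (star w) → U.IsUnion T (star w) → P U)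
    (T : S.Subgraph) : P T := by
  have := S.finite_vert
  have key : ∀ (n : ℕ) (T' : S.Subgraph), (T.verts \ T'.verts).ncard = n →
      T'.verts ⊆ T.verts → T'.edges ⊆ T.edges → P T' → P T := by
    intro n
    induction n using Nat.strong_induction_on with
    | _ n ih =>
      intro T' hn hv he hT'
      by_cases hne : T' = T
      · exact hne ▸ hT'
      obtain ⟨e, heT', w, hwT, hwT', hew⟩ := exists_incident_of_subset hv hne he
      obtain ⟨U, hU⟩ := exists_isUnion (T := T') (T' := star w) heT' hew
      have hUv : U.verts = T'.verts ∪ {w} := hU.1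
      refine ih _ ?_ U rfl ?_ ?_ (h_union T' U w e hT' (isInter_star hwT' heT' hew) hU)
      · rw [← hn]
        refine Set.ncard_lt_ncard ⟨?_, fun hsub => ?_⟩ (Set.toFinite _)
        · exact Set.sdiff_subset_sdiff_right (by rw [hUv]; exact Set.subset_union_left)
        · exact (hsub ⟨hwT, hwT'⟩).2 (by rw [hUv]; exact Or.inr rfl)
      · rw [hUv]
        exact Set.union_subset hv (Set.singleton_subset_iff.mpr hwT)
      · rw [hU.2]
        exact Set.union_subset he (T.nbhd_subset w hwT)
  obtain ⟨e, he⟩ := T.edges_nonempty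
  refine key _ (edge e) rfl (Set.empty_subset _) ?_ (h_edge e)
  rintro _ rfl
  exact he

/-- A subgraph without legs would be the whole tree, which has a leg. -/
theorem legs_nonempty (T : S.Subgraph) : T.legs.Nonempty := by
  by_contra hT
  rw [Set.not_nonempty_iff_eq_empty] at hT
  have hint : ∀ e ∈ T.edges, ∃ v ∈ T.verts, ∃ w ∈ T.verts,
      v ≠ w ∧ e ∈ S.nbhd v ∧ e ∈ S.nbhd w := by
    intro e he
    by_contra h
    exact (hT.subset ⟨he, h⟩ : e ∈ (∅ : Set S.Edge))
  obtain ⟨e, he⟩ := T.edges_nonempty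
  have hall : ∀ a, Sum.elim (· ∈ T.verts) (· ∈ T.edges) a := by
    intro a
    have hr := S.contractible.connected.preconnected (Sum.inr e) a
    refine (hr.iff_of_adj (F := Sum.elim (· ∈ T.verts) (· ∈ T.edges)) fun x y hxy =>
      sum_elim_iff_of_adj (V := Set.univ) ?_ (by simp) (by simp) hxy).mp he
    refine fun v _ e hev => ⟨fun hv => T.nbhd_subset v hv hev, fun he => ?_⟩
    obtain ⟨a, ha, b, hb, hab, hea, heb⟩ := hint e he
    by_cases hva : v = a
    · exact hva ▸ ha
    · rwa [eq_of_mem_nbhd_of_mem_nbhd_of_mem_nbhd hev heb hea hva hab.symm]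
  obtain ⟨v, -, w, -, h⟩ := hint _ (hall (Sum.inr (S.ord 0).1))
  exact (S.ord 0).2.2 ⟨v, trivial, w, trivial, h⟩

end Subgraph

end UTree

namespace UTree

open CycOperad Subgraph

variable {S : UTree.{u}}

/-! ### The operation determined by a subgraph -/

namespace Subgraph

theorem legs_star (v : S.Vert) : (star v).legs = S.nbhd v := by
  refine Set.Subset.antisymm (fun e he => he.1) fun e he => ⟨he, ?_⟩
  rintro ⟨a, rfl, b, rfl, hab, -⟩
  exact hab rfl

theorem boundary_edge (e : S.Edge) : (edge e).boundary = {e, e} := by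
  have h : ∃ e', edge e = edge e' := ⟨e, rfl⟩
  have := S.finite_edge
  have hf : (edge e).edges.toFinite.toFinset = {e} := by
    ext f; simp [edge]
  rw [boundary, if_pos h]
  simp only [hf, Finset.singleton_val]
  rfl

theorem boundary_nodup {T : S.Subgraph} (hT : T.verts.Nonempty) : T.boundary.Nodup := by
  have h : ¬ ∃ e, T = edge e := by
    rintro ⟨e, rfl⟩
    exact Set.not_nonempty_empty hT
  rw [boundary, if_neg h]
  exact Finset.nodup _

theorem mem_boundary {T : S.Subgraph} (hT : T.verts.Nonempty) {e : S.Edge} :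
    e ∈ T.boundary ↔ e ∈ T.legs := by
  have h : ¬ ∃ e, T = edge e := by
    rintro ⟨e, rfl⟩
    exact Set.not_nonempty_empty hT
  rw [boundary, if_neg h]
  simp

theorem eq_edge_of_boundary_eq {T : S.Subgraph} {e : S.Edge} (h : T.boundary = {e, e}) :
    T = edge e := by
  rcases T.verts.eq_empty_or_nonempty with hT | hT
  · obtain ⟨f, rfl⟩ := exists_eq_edge hT
    have hfe : f ∈ ({e, e} : Multiset S.Edge) := by rw [← h, boundary_edge]; simp
    obtain rfl : f = e := by simpa using hfe
    rfl
  · have := boundary_nodup hT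
    rw [h] at this
    simp at this

end Subgraph

/-- A subgraph `T` and the orbit of the operation of `C(S)` it determines. Compared with
`Represents`, the order of the legs is forgotten, and only subgraphs with vertices are
glued. -/
inductive IsComposite : S.Subgraph → S.cycOperad.Orb → Prop
  | edge (e : S.Edge) : IsComposite (edge e) (orb (P := S.cycOperad) (S.cycOperad.unit e))
  | star (v : S.Vert) : IsComposite (star v) (orb (P := S.cycOperad) (S.gen v))
  | glue {A B U : S.Subgraph} {f : S.Edge} {X Y Z : S.cycOperad.Orb} :
      IsComposite A X → IsComposite B Y → A.verts.Nonempty → B.verts.Nonempty →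
      (Subgraph.edge f).IsInter A B → U.IsUnion A B → SymmGlue (P := S.cycOperad) f X Y Z →
      IsComposite U Z

namespace IsComposite

variable {T A B U T₁ T₂ : S.Subgraph} {e f : S.Edge} {X Y Z a b : S.cycOperad.Orb}

theorem eq_unit (h : IsComposite T X) (hT : T = Subgraph.edge e) :
    X = orb (P := S.cycOperad) (S.cycOperad.unit e) := by
  cases h with
  | edge e' => rw [edge_injective hT]
  | star v =>
    exact absurd (congrArg Subgraph.verts hT) (Set.singleton_ne_empty v)
  | glue hA hB hAv hBv hI hU hZ =>
    have : T.verts = ∅ := congrArg Subgraph.verts hT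
    rw [hU.1] at this
    exact absurd (Set.union_empty_iff.mp this).1 hAv.ne_empty

theorem eq_gen {v : S.Vert} (h : IsComposite T X) (hT : T = Subgraph.star v) :
    X = orb (P := S.cycOperad) (S.gen v) := by
  cases h with
  | edge e' =>
    exact absurd (congrArg Subgraph.verts hT.symm) (Set.singleton_ne_empty v)
  | star w =>
    obtain rfl : w = v := Set.singleton_injective (congrArg Subgraph.verts hT)
    rfl
  | glue hA hB hAv hBv hI hU hZ =>
    have hv : T.verts = {v} := congrArg Subgraph.verts hT
    obtain ⟨w, hw⟩ := hAv
    obtain ⟨w', hw'⟩ := hBv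
    obtain rfl : w = v := hv.subset (hU.1 ▸ Or.inl hw)
    obtain rfl : w' = w := hv.subset (hU.1 ▸ Or.inr hw')
    exact absurd hw' (hI.notMem hw)

theorem distinctColors_and_colors_eq (h : IsComposite T X) (hT : T.verts.Nonempty) :
    X.DistinctColors ∧ X.colors = T.legs := by
  induction h with
  | edge e => exact absurd hT Set.not_nonempty_empty
  | star v =>
    refine ⟨Subtype.val_injective.comp (S.ordV v).injective, ?_⟩
    rw [legs_star]
    exact ((S.ordV v).surjective.range_comp _).trans Subtype.range_val
  | glue _ _ hA hB hI hU hZ ihA ihB =>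
    obtain ⟨hXi, hXc⟩ := ihA hA
    obtain ⟨hYi, hYc⟩ := ihB hB
    rw [legs_union hA hB hI hU, ← hXc, ← hYc]
    refine hZ.distinctColors_and_colors_eq hXi hYi ?_
    rw [hXc, hYc]
    exact fun e he => hI.eq_of_mem he.1.1 he.2.1

/-- The inductive step of `split`, for a splitting of `A ∪ B` in which one part lies in `A`. -/
theorem split_of_subset
    (hsplit : ∀ {T₁ T₂ : S.Subgraph} {e : S.Edge}, T₁.verts.Nonempty → T₂.verts.Nonempty →
      (Subgraph.edge e).IsInter T₁ T₂ → A.IsUnion T₁ T₂ → ∃ X₁ X₂, IsComposite T₁ X₁ ∧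
        IsComposite T₂ X₂ ∧ SymmGlue (P := S.cycOperad) e X₁ X₂ a)
    (ha : IsComposite A a) (hb : IsComposite B b) (hA : A.verts.Nonempty) (hB : B.verts.Nonempty)
    (hI : (Subgraph.edge f).IsInter A B) (hU : U.IsUnion A B)
    (hZ : SymmGlue (P := S.cycOperad) f a b Z) (h₂ : T₂.verts.Nonempty)
    (hI' : (Subgraph.edge e).IsInter T₁ T₂) (hU' : U.IsUnion T₁ T₂) (hf₁ : f ∈ T₁.edges)
    (hf₂ : f ∉ T₂.edges) (hv : T₂.verts ⊆ A.verts) (he : T₂.edges ⊆ A.edges) :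
    ∃ X₁ X₂, IsComposite T₁ X₁ ∧ IsComposite T₂ X₂ ∧
      SymmGlue (P := S.cycOperad) e X₁ X₂ Z := by
  obtain ⟨I, hIA⟩ := exists_isInter hf₁ hI.mem_left
  -- `A` splits along `e` into `I = T₁ ∩ A` and `T₂`
  have hIT₂ : (Subgraph.edge e).IsInter I T₂ := by
    refine ⟨?_, ?_⟩
    · rw [hI'.1, hIA.1, Set.inter_assoc, Set.inter_eq_self_of_subset_right hv]
    · rw [hI'.2, hIA.2, Set.inter_assoc, Set.inter_eq_self_of_subset_right he]
  have hAI : A.IsUnion I T₂ := by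
    refine ⟨?_, ?_⟩
    · rw [hIA.1, Set.inter_union_distrib_right, ← hU'.1, Set.union_eq_self_of_subset_right hv,
        Set.inter_eq_self_of_subset_right (by rw [hU.1]; exact Set.subset_union_left)]
    · rw [hIA.2, Set.inter_union_distrib_right, ← hU'.2, Set.union_eq_self_of_subset_right he,
        Set.inter_eq_self_of_subset_right (by rw [hU.2]; exact Set.subset_union_left)]
  have hIv : I.verts.Nonempty := by
    obtain ⟨v, hvA, hfv⟩ := exists_incident hA hI.mem_left
    rw [hAI.1] at hvA
    exact ⟨v, hvA.resolve_right fun hv₂ => hf₂ (T₂.nbhd_subset v hv₂ hfv)⟩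
  -- `T₁` splits along `f` into `I` and `B`
  have hIB : (Subgraph.edge f).IsInter I B := by
    refine ⟨?_, ?_⟩
    · rw [hIA.1, Set.inter_assoc, ← hI.1]
      exact (Set.inter_empty _).symm
    · rw [hIA.2, Set.inter_assoc, ← hI.2]
      exact (Set.inter_eq_self_of_subset_right (Set.singleton_subset_iff.mpr hf₁)).symm
  have hT₁ : T₁.IsUnion I B := by
    refine ⟨?_, ?_⟩
    · refine Set.Subset.antisymm (fun v hv₁ => ?_) (Set.union_subset ?_ fun v hvB => ?_)
      · have : v ∈ A.verts ∪ B.verts := hU.1 ▸ hU'.1 ▸ Or.inl hv₁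
        exact this.imp_left fun hvA => hIA.1 ▸ ⟨hv₁, hvA⟩
      · rw [hIA.1]; exact Set.inter_subset_left
      · have : v ∈ T₁.verts ∪ T₂.verts := hU'.1 ▸ hU.1 ▸ Or.inr hvB
        exact this.resolve_right fun hv₂ => hI.notMem (hv hv₂) hvB
    · refine Set.Subset.antisymm (fun g hg₁ => ?_) (Set.union_subset ?_ fun g hgB => ?_)
      · have : g ∈ A.edges ∪ B.edges := hU.2 ▸ hU'.2 ▸ Or.inl hg₁
        exact this.imp_left fun hgA => hIA.2 ▸ ⟨hg₁, hgA⟩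
      · rw [hIA.2]; exact Set.inter_subset_left
      · have : g ∈ T₁.edges ∪ T₂.edges := hU'.2 ▸ hU.2 ▸ Or.inr hgB
        exact this.resolve_right fun hg₂ => hf₂ (hI.eq_of_mem (he hg₂) hgB ▸ hg₂)
  have hfI : f ∈ I.legs := by
    refine ⟨hIB.mem_left, ?_⟩
    rintro ⟨v, hv, w, hw, hvw, hfv, hfw⟩
    obtain ⟨c, hcB, hfc⟩ := exists_incident hB hI.mem_right
    exact hvw (eq_of_mem_nbhd_of_mem_nbhd_of_mem_nbhd hfv hfw hfc
      (fun h => hIB.notMem hv (h ▸ hcB)) (fun h => hIB.notMem hw (h ▸ hcB)))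
  obtain ⟨X₁, X₂, hX₁, hX₂, hX⟩ := hsplit hIv h₂ hIT₂ hAI
  have hef : e ≠ f := fun h => hf₂ (h ▸ hI'.mem_right)
  obtain ⟨C, hC, hCZ⟩ := hX.assoc (hX₁.distinctColors_and_colors_eq hIv).1
    (hX₂.distinctColors_and_colors_eq h₂).1 (hb.distinctColors_and_colors_eq hB).1
    (ha.distinctColors_and_colors_eq hA).1 hZ
    (by rw [(hX₁.distinctColors_and_colors_eq hIv).2]; exact hfI) hef
  exact ⟨C, X₂, glue hX₁ hb hIv hB hIB hT₁ hC, hX₂, hCZ⟩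

/-- If `T` is obtained by gluing `T₁` and `T₂` along an edge, then its operation is the
composite of operations of `T₁` and `T₂`, no matter how it was composed in the first place. -/
theorem split (h : IsComposite T Z) : ∀ {T₁ T₂ : S.Subgraph} {e : S.Edge},
    T₁.verts.Nonempty → T₂.verts.Nonempty → (Subgraph.edge e).IsInter T₁ T₂ →
    T.IsUnion T₁ T₂ → ∃ X₁ X₂, IsComposite T₁ X₁ ∧ IsComposite T₂ X₂ ∧
      SymmGlue (P := S.cycOperad) e X₁ X₂ Z := by
  induction h with
  | edge e =>
    intro T₁ T₂ e h₁ h₂ hI hU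
    exact absurd (Set.union_empty_iff.mp hU.1.symm).1 h₁.ne_empty
  | star v =>
    intro T₁ T₂ e h₁ h₂ hI hU
    obtain ⟨w, hw⟩ := h₁
    obtain ⟨w', hw'⟩ := h₂
    obtain rfl : w = v := hU.1.symm.subset (Or.inl hw)
    obtain rfl : w' = w := hU.1.symm.subset (Or.inr hw')
    exact absurd hw' (hI.notMem hw)
  | @glue A B U f a b Z ha hb hA hB hI hU hZ ihA ihB =>
    intro T₁ T₂ e h₁ h₂ hI' hU'
    have hv : T₁.verts ∪ T₂.verts = A.verts ∪ B.verts := hU'.1.symm.trans hU.1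
    have he : T₁.edges ∪ T₂.edges = A.edges ∪ B.edges := hU'.2.symm.trans hU.2
    by_cases hef : e = f
    · subst hef
      -- the edge `e` is a leg of both `T₁` and `T₂`
      have hleg : ∀ {T₁ T₂ : S.Subgraph}, T₂.verts.Nonempty →
          (Subgraph.edge e).IsInter T₁ T₂ →
          ∀ v ∈ T₁.verts, ∀ w ∈ T₁.verts, e ∈ S.nbhd v → e ∈ S.nbhd w → v = w := by
        intro T₁ T₂ h₂ hI' v hv w hw hev hew
        obtain ⟨c, hc, hec⟩ := exists_incident h₂ hI'.mem_right
        exact eq_of_mem_nbhd_of_mem_nbhd_of_mem_nbhd hev hew hec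
          (fun h => hI'.notMem hv (h ▸ hc)) (fun h => hI'.notMem hw (h ▸ hc))
      -- hence the two splittings agree
      have heq : ∀ {A B : S.Subgraph}, A.verts.Nonempty → (Subgraph.edge e).IsInter A B →
          T₁.verts ∪ T₂.verts = A.verts ∪ B.verts → T₁.verts ⊆ A.verts →
          T₂.verts ⊆ B.verts → T₁ = A := by
        intro A B hA hI hv hs₁ hs₂
        refine ext_verts h₁ (hs₁.antisymm fun v hvA => ?_)
        have : v ∈ T₁.verts ∪ T₂.verts := hv ▸ Or.inl hvA
        exact this.resolve_right fun h => hI.notMem hvA (hs₂ h)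
      have heq' : ∀ {A B : S.Subgraph}, B.verts.Nonempty → (Subgraph.edge e).IsInter A B →
          T₁.verts ∪ T₂.verts = A.verts ∪ B.verts → T₁.verts ⊆ A.verts →
          T₂.verts ⊆ B.verts → T₂ = B := by
        intro A B hB hI hv hs₁ hs₂
        refine ext_verts h₂ (hs₂.antisymm fun v hvB => ?_)
        have : v ∈ T₁.verts ∪ T₂.verts := hv ▸ Or.inr hvB
        exact this.resolve_left fun h => hI.notMem (hs₁ h) hvB
      rcases verts_edges_subset_or hI (hv ▸ Set.subset_union_left) (he ▸ Set.subset_union_left)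
        (hleg h₂ hI') with ⟨hs₁, -⟩ | ⟨hs₁, -⟩ <;>
      rcases verts_edges_subset_or hI (hv ▸ Set.subset_union_right)
        (he ▸ Set.subset_union_right) (hleg h₁ hI'.symm) with ⟨hs₂, -⟩ | ⟨hs₂, -⟩
      · obtain ⟨v, hvB⟩ := hB
        have : v ∈ T₁.verts ∪ T₂.verts := hv ▸ Or.inr hvB
        exact absurd hvB (hI.notMem (this.elim (hs₁ ·) (hs₂ ·)))
      · obtain rfl := heq hA hI hv hs₁ hs₂
        obtain rfl := heq' hB hI hv hs₁ hs₂
        exact ⟨a, b, ha, hb, hZ⟩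
      · obtain rfl := heq hB hI.symm (hv.trans (Set.union_comm _ _)) hs₁ hs₂
        obtain rfl := heq' hA hI.symm (hv.trans (Set.union_comm _ _)) hs₁ hs₂
        exact ⟨b, a, hb, ha, hZ.symm⟩
      · obtain ⟨v, hvA⟩ := hA
        have : v ∈ T₁.verts ∪ T₂.verts := hv ▸ Or.inl hvA
        exact absurd (this.elim (hs₁ ·) (hs₂ ·)) (hI.notMem hvA)
    · -- the part of the second splitting that does not contain `f` lies in `A` or in `B`
      have key : ∀ {T₁ T₂ : S.Subgraph}, T₁.verts.Nonempty → T₂.verts.Nonempty →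
          (Subgraph.edge e).IsInter T₁ T₂ → U.IsUnion T₁ T₂ → f ∈ T₁.edges →
          ∃ X₁ X₂, IsComposite T₁ X₁ ∧ IsComposite T₂ X₂ ∧
            SymmGlue (P := S.cycOperad) e X₁ X₂ Z := by
        intro T₁ T₂ h₁ h₂ hI' hU' hf₁
        have hf₂ : f ∉ T₂.edges := fun hf₂ => hef (hI'.eq_of_mem hf₁ hf₂).symm
        rcases verts_edges_subset_or hI (T := T₂)
          (by rw [← hU.1, hU'.1]; exact Set.subset_union_right)
          (by rw [← hU.2, hU'.2]; exact Set.subset_union_right)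
          (fun v hv _ _ hfv => absurd (T₂.nbhd_subset v hv hfv) hf₂) with ⟨hs, hs'⟩ | ⟨hs, hs'⟩
        · exact split_of_subset ihA ha hb hA hB hI hU hZ h₂ hI' hU' hf₁ hf₂ hs hs'
        · exact split_of_subset ihB hb ha hB hA hI.symm hU.symm hZ.symm h₂ hI' hU' hf₁ hf₂ hs hs'
      have hf : f ∈ T₁.edges ∪ T₂.edges := he ▸ Or.inl hI.mem_left
      rcases hf with hf₁ | hf₂
      · exact key h₁ h₂ hI' hU' hf₁
      · obtain ⟨X₂, X₁, hX₂, hX₁, hX⟩ := key h₂ h₁ hI'.symm hU'.symm hf₂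
        exact ⟨X₁, X₂, hX₁, hX₂, hX.symm⟩

/-- All ways of composing the vertices of a subgraph give the same operation. -/
theorem unique (h : IsComposite T X) : ∀ {Y}, IsComposite T Y → X = Y := by
  induction h with
  | edge e => exact fun h' => (h'.eq_unit rfl).symm
  | star v => exact fun h' => (h'.eq_gen rfl).symm
  | glue ha hb hA hB hI hU hZ ihA ihB =>
    intro Y h'
    obtain ⟨a', b', ha', hb', hY⟩ := h'.split hA hB hI hU
    obtain rfl := ihA ha'
    obtain rfl := ihB hb'
    exact hZ.unique (ha.distinctColors_and_colors_eq hA).1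
      (hb.distinctColors_and_colors_eq hB).1 hY

end IsComposite

namespace Represents

variable {T U A B : S.Subgraph} {n : ℕ}

theorem isComposite {x : S.cycOperad.Op n} (h : Represents T x) :
    IsComposite T (orb (P := S.cycOperad) x) := by
  induction h with
  | edge e => exact .edge e
  | star v => exact .star v
  | act σ _ ih => rwa [orb_act]
  | @comp k l n T T' U x y h i hi hc _ _ hI hU ihx ihy =>
    rcases T.verts.eq_empty_or_nonempty with hT | hT
    · obtain ⟨hTe, rfl⟩ := hU.eq_of_left_verts_eq_empty hI hT
      rwa [orb_comp_of_left_eq_unit (P := S.cycOperad) h i hi x y hc (ihx.eq_unit hTe)]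
    rcases T'.verts.eq_empty_or_nonempty with hT' | hT'
    · obtain ⟨hTe, rfl⟩ := hU.symm.eq_of_left_verts_eq_empty hI.symm hT'
      rwa [orb_comp_of_right_eq_unit (P := S.cycOperad) h i hi x y hc (ihy.eq_unit hTe)]
    exact .glue ihx ihy hT hT' hI hU
      (Or.inl ⟨k, l, n, h, i, hi, x, y, hc, rfl, rfl, rfl, rfl⟩)

theorem of_orb_eq {m : ℕ} {x : S.cycOperad.Op n} {y : S.cycOperad.Op m} (h : Represents T x)
    (hxy : orb (P := S.cycOperad) x = orb (P := S.cycOperad) y) : Represents T y := by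
  obtain rfl := arity_eq_of_orb_eq hxy
  obtain ⟨σ, rfl⟩ := exists_act_eq_of_orb_eq hxy
  exact h.act σ

theorem eq_unit_of_edge {e : S.Edge} {x : S.cycOperad.Op 1} (h : Represents (Subgraph.edge e) x) :
    x = S.cycOperad.unit e :=
  eq_unit_of_orb_eq (h.isComposite.eq_unit rfl)

/-- The operation determined by a subgraph with ordered legs is well defined. -/
theorem unique {x y : S.cycOperad.Op n} (hx : Represents T x) (hy : Represents T y)
    (hxy : S.cycOperad.col x = S.cycOperad.col y) : x = y := by
  have h := hx.isComposite.unique hy.isComposite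
  rcases T.verts.eq_empty_or_nonempty with hT | hT
  · obtain ⟨e, rfl⟩ := exists_eq_edge hT
    obtain rfl : n = 1 := arity_eq_of_orb_eq (hx.isComposite.eq_unit rfl)
    rw [hx.eq_unit_of_edge, hy.eq_unit_of_edge]
  · obtain ⟨σ, rfl⟩ := exists_act_eq_of_orb_eq h
    have hinj : Function.Injective (S.cycOperad.col x) :=
      (hx.isComposite.distinctColors_and_colors_eq hT).1
    have hσ : σ = 1 := Equiv.ext fun j => hinj (by
      rw [S.cycOperad.col_act] at hxy
      exact (congrFun hxy j).symm)
    rw [hσ, S.cycOperad.act_one]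

theorem exists_union {m : ℕ} {x : S.cycOperad.Op n} {y : S.cycOperad.Op m} {e : S.Edge}
    (hx : Represents A x) (hy : Represents B y) (hI : (Subgraph.edge e).IsInter A B)
    (hU : U.IsUnion A B) (hex : e ∈ (orb (P := S.cycOperad) x).colors)
    (hey : e ∈ (orb (P := S.cycOperad) y).colors) (hn : n ≠ 0) :
    ∃ (k : ℕ) (z : S.cycOperad.Op k), Represents U z := by
  obtain ⟨k, x', hxx, hx'⟩ := Orb.exists_rep_of_arity_ne_zero hex hn
  obtain ⟨l, y', hyy, hy'⟩ := Orb.exists_rep_zero hey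
  exact ⟨k + l, _, Represents.comp (by omega) 1 one_ne_zero (hy'.trans hx'.symm)
    (hx.of_orb_eq hxx.symm) (hy.of_orb_eq hyy.symm) (by rwa [hx']) hU⟩

theorem exists_of_subgraph (T : S.Subgraph) : ∃ (n : ℕ) (x : S.cycOperad.Op n), Represents T x := by
  induction T using induction_star with
  | h_edge e => exact ⟨_, _, .edge e⟩
  | h_union T U w e ih hI hU =>
    obtain ⟨n, x, hx⟩ := ih
    rcases T.verts.eq_empty_or_nonempty with hT | hT
    · obtain ⟨-, rfl⟩ := hU.eq_of_left_verts_eq_empty hI hT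
      exact ⟨_, _, .star w⟩
    have hw : (Subgraph.star w).verts.Nonempty := Set.singleton_nonempty w
    have hxc := (hx.isComposite.distinctColors_and_colors_eq hT).2
    have hyc := ((Represents.star w).isComposite.distinctColors_and_colors_eq hw).2
    have hew : e ∈ S.nbhd w := hI.mem_right
    have heT : e ∈ T.legs := by
      refine ⟨hI.mem_left, ?_⟩
      rintro ⟨a, ha, b, hb, hab, hea, heb⟩
      exact hab (eq_of_mem_nbhd_of_mem_nbhd_of_mem_nbhd hea heb hew
        (fun h => hI.notMem ha h) (fun h => hI.notMem hb h))
    have hex : e ∈ (orb (P := S.cycOperad) x).colors := by rw [hxc]; exact heT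
    have hey : e ∈ (orb (P := S.cycOperad) (S.gen w)).colors := by
      rw [hyc, legs_star]; exact hew
    -- the union has a leg, so one of the two operations has more than one leg
    have harity : ∀ {m : ℕ} (y : S.cycOperad.Op m) (f : S.Edge),
        e ∈ (orb (P := S.cycOperad) y).colors → f ∈ (orb (P := S.cycOperad) y).colors →
        f ≠ e → m ≠ 0 := by
      rintro m y _ ⟨j, hj⟩ ⟨j', rfl⟩ hne rfl
      exact hne (hj ▸ congrArg (S.cycOperad.col y) (Subsingleton.elim (α := Fin 1) j' j))
    obtain ⟨f, hf⟩ := U.legs_nonempty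
    rw [legs_union hT hw hI hU] at hf
    rcases hf with ⟨hf, hfe⟩ | ⟨hf, hfe⟩
    · exact hx.exists_union (Represents.star w) hI hU hex hey
        (harity x f hex (by rw [hxc]; exact hf) hfe)
    · exact (Represents.star w).exists_union hx hI.symm hU.symm hey hex
        (harity (S.gen w) f hey (by rw [hyc]; exact hf) hfe)

/-- Every subgraph with every ordering of its legs determines an operation. -/
theorem exists_of_boundary {T : S.Subgraph} {c : Fin (n + 1) → S.Edge}
    (hc : T.boundary = Multiset.map c Finset.univ.val) :
    ∃ x : S.cycOperad.Op n, Represents T x ∧ S.cycOperad.col x = c := by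
  obtain ⟨m, x, hx⟩ := exists_of_subgraph T
  have hmem : ∀ e, e ∈ T.boundary ↔ ∃ j, c j = e := by
    intro e; rw [hc]; simp only [Multiset.mem_map, Finset.mem_val, Finset.mem_univ, true_and]
  rcases T.verts.eq_empty_or_nonempty with hT | hT
  · obtain ⟨e, rfl⟩ := exists_eq_edge hT
    rw [boundary_edge] at hc
    obtain rfl : n = 1 := by simpa using (congrArg Multiset.card hc).symm
    refine ⟨S.cycOperad.unit e, .edge e, ?_⟩
    rw [S.cycOperad.col_unit]
    funext j
    have := (hmem (c j)).mpr ⟨j, rfl⟩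
    rw [boundary_edge] at this
    exact (by simpa using this : c j = e).symm
  · obtain ⟨hxi, hxc⟩ := hx.isComposite.distinctColors_and_colors_eq hT
    have hci : Function.Injective c := by
      rw [← Fintype.nodup_map_univ_iff_injective, ← hc]
      exact boundary_nodup hT
    have hrange : Set.range c = Set.range (S.cycOperad.col x) := by
      ext e
      exact (hmem e).symm.trans ((mem_boundary hT).trans (by rw [← hxc]; rfl))
    obtain rfl : m = n := by
      have h₁ := Set.ncard_range_of_injective hci
      have h₂ := Set.ncard_range_of_injective hxi
      rw [hrange] at h₁
      have := h₂.symm.trans h₁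
      simpa using this
    obtain ⟨σ, hσ⟩ := exists_perm_comp_eq hci (g := S.cycOperad.col x)
      fun j => hrange ▸ Set.mem_range_self j
    exact ⟨S.cycOperad.act x σ, hx.act σ, by rw [S.cycOperad.col_act, hσ]⟩

end Represents

end UTree

namespace CycOperad

/-! ### The universal property of the free cyclic operad -/

section Free

variable {𝔠 Gen : Type u} {ar : Gen → ℕ} {prof : ∀ v, Fin (ar v + 1) → 𝔠}

section Eval

variable {Q : CycOperad.{u}} {f : 𝔠 → Q.Color} {q : ∀ v, Q.Op (ar v)}
  (hq : ∀ v, Q.col (q v) = f ∘ prof v)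

/-- The value in `Q` of a formal composite, given colors and operations of `Q` for the colors and
the generators. -/
def Expr.eval : ∀ {n : ℕ} {c : Fin (n + 1) → 𝔠}, Expr prof n c → {x : Q.Op n // Q.col x = f ∘ c}
  | _, _, .gen v => ⟨q v, hq v⟩
  | _, _, .unit a => ⟨Q.unit (f a), by rw [Q.col_unit]; rfl⟩
  | _, _, .act x σ => ⟨Q.act x.eval.1 σ, by rw [Q.col_act, x.eval.2]; rfl⟩
  | _, _, .comp h i hi g y hc =>
    ⟨Q.comp h i hi g.eval.1 y.eval.1 (by
        rw [g.eval.2, y.eval.2, Function.comp_apply, Function.comp_apply, hc]),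
      by rw [Q.col_comp, g.eval.2, y.eval.2, comp_graft]⟩

theorem Expr.Rel.eval_eq {n : ℕ} {c c' : Fin (n + 1) → 𝔠} {x : Expr prof n c}
    {y : Expr prof n c'} (h : Expr.Rel x y) : (x.eval hq).1 = (y.eval hq).1 := by
  induction h with
  | refl => rfl
  | symm _ ih => exact ih.symm
  | trans _ _ ih ih' => exact ih.trans ih'
  | act_congr σ _ ih => exact congrArg (Q.act · σ) ih
  | comp_congr h i hi hc hc' _ _ ih ih' => exact CycOperad.comp_congr ih rfl ih'
  | act_one x => exact Q.act_one _
  | act_mul x σ τ => exact Q.act_mul _ σ τ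
  | comp_unit h i hi x a hc => exact Q.comp_unit h i hi _ _ _
  | unit_comp h hi x a hc => exact Q.unit_comp h hi _ _ _
  | assoc_seq x y z i j p hi hj hp hpe ha hb hn hn' hxy hyz h₁ h₂ =>
    exact Q.assoc_seq _ _ _ i j p hi hj hp hpe ha hb hn hn' _ _ _ _
  | assoc_par x y z i j p q hi hj hp hq hij hpe hqe ha hb hn hn' hxy hxz h₁ h₂ =>
    exact Q.assoc_par _ _ _ i j p q hi hj hp hq hij hpe hqe ha hb hn hn' _ _ _ _
  | equivariance h i hi g f σ τ hσ hτ ρ hρ hi' hc hc' =>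
    exact Q.equivariance h i hi _ _ σ τ hσ hτ ρ hρ hi' _ _
  | cyclic_inner h i i' g f hi hi' hii hc hc' =>
    exact Q.cyclic_inner h i i' _ _ hi hi' hii _ _
  | cyclic_outer h h' i g f hi hl hi1 hl0 hc hc' =>
    exact Q.cyclic_outer h h' i _ _ hi hl hi1 hl0 _ _

/-- The map out of the free cyclic operad given by values on colors and generators. -/
def FreeOp.lift : Hom (free prof) Q where
  color := f
  op := Quotient.lift (s := exprSetoid prof _) (fun x => (x.2.eval hq).1)
    fun _ _ h => h.eval_eq hq
  col_op X := by
    induction X using FreeOp.ind with | h c x => exact (x.eval hq).2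
  op_unit _ := rfl
  op_act X σ := by
    induction X using FreeOp.ind with | h c x => rfl
  op_comp h i hi X Y hc hc' := by
    induction X using FreeOp.ind with | h c x => ?_
    induction Y using FreeOp.ind with | h d y => ?_
    simp only [FreeOp.comp_mk]
    rfl

end Eval

theorem Hom.ext_free {Q : CycOperad.{u}} {F G : Hom (free prof) Q} (hcolor : F.color = G.color)
    (hgen : ∀ v, F.op (FreeOp.mk (.gen v)) = G.op (FreeOp.mk (.gen v))) : F = G := by
  have hcol : ∀ {n c} (x : Expr prof n c), Q.col (F.op (FreeOp.mk x)) = F.color ∘ c :=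
    fun x => F.col_op _
  have hcol' : ∀ {n c} (x : Expr prof n c), Q.col (G.op (FreeOp.mk x)) = G.color ∘ c :=
    fun x => G.col_op _
  have key : ∀ {n c} (x : Expr prof n c), F.op (FreeOp.mk x) = G.op (FreeOp.mk x) := by
    intro n c x
    induction x with
    | gen v => exact hgen v
    | unit a => exact (F.op_unit a).trans ((congrArg Q.unit (congrFun hcolor a)).trans
        (G.op_unit a).symm)
    | act x σ ih =>
      exact (F.op_act _ σ).trans ((congrArg (Q.act · σ) ih).trans (G.op_act _ σ).symm)
    | comp h i hi g y hc ihg ihy =>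
      have hF := F.op_comp h i hi (FreeOp.mk g) (FreeOp.mk y) hc (by
        rw [hcol, hcol, Function.comp_apply, Function.comp_apply, hc])
      have hG := G.op_comp h i hi (FreeOp.mk g) (FreeOp.mk y) hc (by
        rw [hcol', hcol', Function.comp_apply, Function.comp_apply, hc])
      have hmk := FreeOp.comp_mk h i hi g y hc
      exact (congrArg F.op hmk).symm.trans (hF.trans
        ((CycOperad.comp_congr ihg rfl ihy).trans (hG.symm.trans (congrArg G.op hmk))))
  refine Hom.ext hcolor ?_
  funext n X
  induction X using FreeOp.ind with | h c x => exact key x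

variable (prof) in
theorem isFreeOn_free : (free prof).IsFreeOn fun v => FreeOp.mk (prof := prof) (.gen v) := by
  intro Q f q hq
  refine ⟨FreeOp.lift (prof := prof) hq, ⟨rfl, fun _ => rfl⟩, ?_⟩
  rintro G ⟨rfl, hG⟩
  exact Hom.ext_free rfl hG

/-- The generators occurring in a formal composite, with multiplicities. -/
def Expr.gens : ∀ {n : ℕ} {c : Fin (n + 1) → 𝔠}, Expr prof n c → Multiset Gen
  | _, _, .gen v => {v}
  | _, _, .unit _ => 0
  | _, _, .act x _ => x.gens
  | _, _, .comp _ _ _ g y _ => g.gens + y.gens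

theorem Expr.Rel.gens_eq {n : ℕ} {c c' : Fin (n + 1) → 𝔠} {x : Expr prof n c}
    {y : Expr prof n c'} (h : Expr.Rel x y) : x.gens = y.gens := by
  induction h with
  | refl => rfl
  | symm _ ih => exact ih.symm
  | trans _ _ ih ih' => exact ih.trans ih'
  | act_congr σ _ ih => exact ih
  | comp_congr h i hi hc hc' _ _ ih ih' => exact congrArg₂ (· + ·) ih ih'
  | act_one x => rfl
  | act_mul x σ τ => rfl
  | comp_unit h i hi x a hc => exact add_zero _
  | unit_comp h hi x a hc => exact zero_add _
  | assoc_seq => exact add_assoc _ _ _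
  | assoc_par => exact add_right_comm _ _ _
  | equivariance => rfl
  | cyclic_inner => rfl
  | cyclic_outer => exact add_comm _ _

/-- The generators occurring in an operation of the free cyclic operad, with multiplicities. -/
def FreeOp.gens {n : ℕ} : FreeOp prof n → Multiset Gen :=
  Quotient.lift (s := exprSetoid prof n) (fun x => x.2.gens) fun _ _ h => h.gens_eq

theorem FreeOp.gens_act {n : ℕ} (X : FreeOp prof n) (σ) : (X.act σ).gens = X.gens := by
  induction X using FreeOp.ind with | h c x => rfl

theorem FreeOp.gens_comp {k l n : ℕ} (h : n + 1 = k + l) (i : Fin (k + 1)) (hi : i ≠ 0)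
    (X : FreeOp prof k) (Y : FreeOp prof l) (hc) :
    (FreeOp.comp h i hi X Y hc).gens = X.gens + Y.gens := by
  induction X using FreeOp.ind with | h c x => ?_
  induction Y using FreeOp.ind with | h d y => ?_
  rw [FreeOp.comp_mk]
  rfl

end Free

end CycOperad

namespace UTree

open CycOperad Subgraph

variable {R S : UTree.{u}}

/-! ### Recovering a subgraph from its operation -/

theorem Represents.gens {n : ℕ} {T : S.Subgraph} {x : S.cycOperad.Op n} (h : Represents T x) :
    (FreeOp.gens x).Nodup ∧ ∀ v, v ∈ FreeOp.gens x ↔ v ∈ T.verts := by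
  induction h with
  | edge e =>
    exact ⟨Multiset.nodup_zero, fun v =>
      iff_of_false (Multiset.notMem_zero v) (Set.notMem_empty v)⟩
  | star v =>
    exact ⟨Multiset.nodup_singleton v, fun w => Multiset.mem_singleton⟩
  | act σ _ ih => rwa [FreeOp.gens_act]
  | comp h i hi hc _ _ hI hU ihx ihy =>
    rw [FreeOp.gens_comp, hU.1]
    refine ⟨Multiset.nodup_add.mpr ⟨ihx.1, ihy.1, ?_⟩, fun v => ?_⟩
    · exact Multiset.disjoint_left.mpr fun {v} hvx hvy =>
        hI.notMem ((ihx.2 v).mp hvx) ((ihy.2 v).mp hvy)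
    · rw [Multiset.mem_add, ihx.2, ihy.2, Set.mem_union]

theorem Represents.subgraph_unique {n : ℕ} {T T' : S.Subgraph} {x : S.cycOperad.Op n}
    (h : Represents T x) (h' : Represents T' x) : T = T' := by
  have hv : T.verts = T'.verts := Set.ext fun v => (h.gens.2 v).symm.trans (h'.gens.2 v)
  rcases T.verts.eq_empty_or_nonempty with hT | hT
  · obtain ⟨e, rfl⟩ := exists_eq_edge hT
    obtain ⟨e', rfl⟩ := exists_eq_edge (hv.symm.trans hT)
    obtain rfl : n = 1 := arity_eq_of_orb_eq (h.isComposite.eq_unit rfl)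
    have hee : S.cycOperad.unit e = S.cycOperad.unit e' :=
      h.eq_unit_of_edge.symm.trans h'.eq_unit_of_edge
    have hcol := congrFun (congrArg S.cycOperad.col hee) 0
    rw [S.cycOperad.col_unit, S.cycOperad.col_unit] at hcol
    exact congrArg Subgraph.edge hcol
  · exact ext_verts hT hv

/-! ### The map induced by a morphism of trees -/

theorem Subgraph.boundary_star (v : S.Vert) :
    (star v).boundary = Multiset.map (fun j => (S.ordV v j : S.Edge)) Finset.univ.val := by
  have hv : (star v).verts.Nonempty := Set.singleton_nonempty v
  refine (Multiset.Nodup.ext (boundary_nodup hv) ?_).mpr fun e => ?_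
  · exact Fintype.nodup_map_univ_iff_injective.mpr
      (Subtype.val_injective.comp (S.ordV v).injective)
  · rw [mem_boundary hv, legs_star, Multiset.mem_map]
    simp only [Finset.mem_val, Finset.mem_univ, true_and]
    refine ⟨fun he => ⟨(S.ordV v).symm ⟨e, he⟩, by simp⟩, ?_⟩
    rintro ⟨j, rfl⟩
    exact (S.ordV v j).2

theorem Hom.onSub_edge (φ : Hom R S) (e : R.Edge) : φ.onSub (edge e) = edge (φ.onEdge e) := by
  refine eq_edge_of_boundary_eq ?_
  rw [φ.boundary_onSub, boundary_edge]
  simp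

theorem exists_isInduced (φ : R ⟶ S) : ∃ F : R.cycOperad ⟶ S.cycOperad, IsInduced φ F := by
  have hex : ∀ v : R.Vert, ∃ x : S.cycOperad.Op (R.ar v),
      Represents (Hom.onSub φ (star v)) x ∧
        S.cycOperad.col x = Hom.onEdge φ ∘ fun j => (R.ordV v j : R.Edge) := by
    intro v
    refine Represents.exists_of_boundary ?_
    rw [Hom.boundary_onSub φ, boundary_star, Multiset.map_map]
  choose q hq hqc using hex
  obtain ⟨F, ⟨hF, hFg⟩, -⟩ := isFreeOn_free (fun v j => (R.ordV v j : R.Edge)) S.cycOperad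
    (Hom.onEdge φ) q hqc
  exact ⟨F, hF, fun v => (hFg v).symm ▸ hq v⟩

theorem IsInduced.unique {φ : R ⟶ S} {F G : R.cycOperad ⟶ S.cycOperad} (hF : IsInduced φ F)
    (hG : IsInduced φ G) : F = G := by
  have hc : CycOperad.Hom.color F = CycOperad.Hom.color G := hF.1.trans hG.1.symm
  refine CycOperad.Hom.ext_free hc fun v => (hF.2 v).unique (hG.2 v) ?_
  exact (CycOperad.Hom.col_op F _).trans ((congrArg (· ∘ _) hc).trans
    (CycOperad.Hom.col_op G _).symm)

/-- An induced map sends the operation of every subgraph, not only of those with one vertex, to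
the operation of the image subgraph. -/
theorem IsInduced.represents {φ : R ⟶ S} {F : R.cycOperad ⟶ S.cycOperad} (hF : IsInduced φ F)
    {n : ℕ} {T : R.Subgraph} {x : R.cycOperad.Op n} (h : Represents T x) :
    Represents (Hom.onSub φ T) (CycOperad.Hom.op F x) := by
  have hcol : ∀ {n : ℕ} (x : R.cycOperad.Op n) j,
      S.cycOperad.col (CycOperad.Hom.op F x) j = Hom.onEdge φ (R.cycOperad.col x j) := by
    intro n x j
    rw [CycOperad.Hom.col_op F, hF.1]
    rfl
  induction h with
  | edge e =>
    rw [Hom.onSub_edge φ, CycOperad.Hom.op_unit F, hF.1]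
    exact .edge _
  | star v => exact hF.2 v
  | act σ _ ih =>
    rw [CycOperad.Hom.op_act F]
    exact ih.act σ
  | @comp k l n T T' U x y h i hi hc _ _ hI hU ihx ihy =>
    have hc' : S.cycOperad.col (CycOperad.Hom.op F y) 0 =
        S.cycOperad.col (CycOperad.Hom.op F x) i := by rw [hcol, hcol, hc]
    rw [CycOperad.Hom.op_comp F h i hi x y hc hc']
    refine .comp h i hi hc' ihx ihy ?_ (Hom.union φ hI.overlap hU)
    rw [hcol, ← Hom.onSub_edge φ]
    exact Hom.inter φ hI.overlap hI

theorem IsInduced.comp {S' : UTree.{u}} {φ : R ⟶ S} {ψ : S ⟶ S'}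
    {F : R.cycOperad ⟶ S.cycOperad} {G : S.cycOperad ⟶ S'.cycOperad} (hF : IsInduced φ F)
    (hG : IsInduced ψ G) : IsInduced (φ ≫ ψ) (F ≫ G) := by
  refine ⟨?_, fun v => hG.represents (hF.2 v)⟩
  change CycOperad.Hom.color G ∘ CycOperad.Hom.color F = Hom.onEdge ψ ∘ Hom.onEdge φ
  rw [hF.1, hG.1]

theorem isInduced_id (S : UTree.{u}) : IsInduced (𝟙 S) (𝟙 S.cycOperad) :=
  ⟨rfl, fun v => .star v⟩

theorem IsInduced.injective {φ ψ : R ⟶ S} {F : R.cycOperad ⟶ S.cycOperad} (hφ : IsInduced φ F)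
    (hψ : IsInduced ψ F) : φ = ψ := by
  have hedge : Hom.onEdge φ = Hom.onEdge ψ := hφ.1.symm.trans hψ.1
  refine Hom.ext hedge (funext fun T => ?_)
  induction T using induction_star with
  | h_edge e => rw [Hom.onSub_edge φ, Hom.onSub_edge ψ, hedge]
  | h_union T U w e ih hI hU =>
    have hφU := Hom.union φ hI.overlap hU
    rw [ih, (hφ.2 w).subgraph_unique (hψ.2 w)] at hφU
    exact hφU.unique (Hom.union ψ hI.overlap hU)

/-! ### The functor -/

/-- The functor sending a tree `S` to `C(S)` and a morphism to the map it induces. -/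
noncomputable def cycFunctor : UTree.{u} ⥤ CycOperad.{u} where
  obj S := S.cycOperad
  map φ := (exists_isInduced φ).choose
  map_id S := (exists_isInduced (𝟙 S)).choose_spec.unique (isInduced_id S)
  map_comp φ ψ := (exists_isInduced (φ ≫ ψ)).choose_spec.unique
    ((exists_isInduced φ).choose_spec.comp (exists_isInduced ψ).choose_spec)

theorem isCycFunctor_cycFunctor : IsCycFunctor cycFunctor.{u} := by
  refine ⟨fun _ => rfl, fun φ => ?_⟩
  change IsInduced φ (𝟙 _ ≫ (exists_isInduced φ).choose ≫ 𝟙 _)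
  rw [Category.id_comp, Category.comp_id]
  exact (exists_isInduced φ).choose_spec

theorem IsCycFunctor.unique {C D : UTree.{u} ⥤ CycOperad.{u}} (hC : IsCycFunctor C)
    (hD : IsCycFunctor D) : C = D := by
  obtain ⟨hC, hCφ⟩ := hC
  obtain ⟨hD, hDφ⟩ := hD
  refine CategoryTheory.Functor.ext (fun S => (hC S).trans (hD S).symm) fun R S φ => ?_
  have h := (hCφ φ).unique (hDφ φ)
  rw [eqToHom_comp_iff, comp_eqToHom_iff] at h
  simpa using h

theorem IsCycFunctor.faithful {C : UTree.{u} ⥤ CycOperad.{u}} (hC : IsCycFunctor C) :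
    C.Faithful := by
  obtain ⟨hobj, hC⟩ := hC
  refine ⟨fun {R S φ ψ} h => (hC φ).injective ?_⟩
  rw [h]
  exact hC ψ

/-! ### A map of cyclic operads not induced by a morphism of trees -/

/-- The tree with one vertex and two edges. -/
def bivalentCorolla : UTree.{u} where
  Edge := ULift (Fin 2)
  Vert := PUnit
  finite_edge := inferInstance
  finite_vert := inferInstance
  nbhd _ := Set.univ
  incident_le_two e := by
    refine (Set.encard_le_encard (Set.subset_univ _)).trans ?_
    rw [Set.encard_univ, ENat.card_eq_coe_fintype_card]
    simp
  contractible := by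
    convert SimpleGraph.isTree_starGraph
      (Sum.inl PUnit.unit : PUnit.{u + 1} ⊕ ULift.{u} (Fin 2)) using 1
    ext (v | ⟨e⟩) (w | ⟨f⟩)
    · simp [LegGraph.incidence]
    · fin_cases f <;> simp [LegGraph.incidence]
    · fin_cases e <;> simp [LegGraph.incidence]
    · simp [LegGraph.incidence]
  ar _ := 1
  ordV _ := Equiv.ulift.symm.trans (Equiv.Set.univ _).symm
  arity := 1
  ord j := ⟨⟨j⟩, trivial, fun ⟨v, _, w, _, h, _⟩ => h (Subsingleton.elim v w)⟩
  ord_bijective _ := by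
    exact ⟨fun i j h => congrArg (fun e => ULift.down e.1) h, fun ⟨⟨j⟩, _⟩ => ⟨j, rfl⟩⟩
  ord_of_isEmpty h := (h.false PUnit.unit).elim

/-- For the generator `v` with legs `e₀` and `e₁`, there is a map fixing `e₀`, sending `e₁` to `e₀`
and `v` to the composite of two copies of `v` along `e₁`. It is not induced by a morphism of
trees, since in the operation of a subgraph each vertex occurs at most once. -/
theorem exists_forall_not_isInduced : ∃ F : bivalentCorolla.{u}.cycOperad ⟶
    bivalentCorolla.{u}.cycOperad, ∀ φ, ¬ IsInduced φ F := by
  let P := bivalentCorolla.{u}.cycOperad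
  let v : P.Op 1 := bivalentCorolla.{u}.gen PUnit.unit
  have hv : ∀ j, P.col v j = ⟨j⟩ := fun j => rfl
  let w : P.Op 1 := P.act v (finRotate 2)
  have hw : ∀ j, P.col w j = ⟨finRotate 2 j⟩ := fun j => congrFun (P.col_act v (finRotate 2)) j
  have hc : P.col w 0 = P.col v 1 := by rw [hv, hw]; rfl
  let x : P.Op 1 := P.comp (k := 1) (l := 1) rfl 1 one_ne_zero v w hc
  have hx : P.col x = fun _ => ⟨0⟩ := by
    rw [P.col_comp]
    funext j
    fin_cases j
    · exact (graft_zero one_ne_zero).trans (hv 0)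
    · exact (graft_right (w := 1) one_ne_zero rfl).trans (hw 1)
  obtain ⟨F, ⟨-, hF⟩, -⟩ := isFreeOn_free
    (fun v j => (bivalentCorolla.{u}.ordV v j : bivalentCorolla.{u}.Edge)) P
    (fun _ => ⟨0⟩) (fun _ => x) (fun _ => hx)
  refine ⟨F, fun φ hφ => ?_⟩
  have hgens := (hφ.2 PUnit.unit).gens.1
  have hFx : CycOperad.Hom.op F (bivalentCorolla.{u}.gen PUnit.unit) = x := hF PUnit.unit
  have hxg : FreeOp.gens x = {PUnit.unit, PUnit.unit} := by
    refine (FreeOp.gens_comp rfl 1 one_ne_zero v w hc).trans ?_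
    rw [show FreeOp.gens w = FreeOp.gens v from FreeOp.gens_act v _]
    rfl
  rw [hFx] at hgens
  have hnodup : ({PUnit.unit, PUnit.unit} : Multiset PUnit.{u + 1}).Nodup :=
    (congrArg Multiset.Nodup hxg).mp hgens
  simp at hnodup

theorem IsCycFunctor.not_full {C : UTree.{u} ⥤ CycOperad.{u}} (hC : IsCycFunctor C) :
    ¬ C.Full := by
  intro hfull
  obtain ⟨hobj, hC⟩ := hC
  obtain ⟨F, hF⟩ := exists_forall_not_isInduced.{u}
  obtain ⟨φ, hφ⟩ := hfull.map_surjective (eqToHom (hobj _) ≫ F ≫ eqToHom (hobj _).symm)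
  refine hF φ ?_
  have := hC φ
  rw [hφ] at this
  simpa using this

end UTree

theorem theorem5p3 :
    (∀ S : UTree.{u},
      (∀ v j, S.cycOperad.col (S.gen v) j = (S.ordV v j : S.Edge)) ∧
      S.cycOperad.IsFreeOn S.gen) ∧
    (∃! C : UTree.{u} ⥤ CycOperad.{u}, UTree.IsCycFunctor C) ∧
    ∀ C : UTree.{u} ⥤ CycOperad.{u}, UTree.IsCycFunctor C → C.Faithful ∧ ¬ C.Full :=
  ⟨fun S => ⟨fun _ _ => rfl, CycOperad.isFreeOn_free fun v j => (S.ordV v j : S.Edge)⟩,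
    ⟨UTree.cycFunctor, UTree.isCycFunctor_cycFunctor,
      fun _ hC => hC.unique UTree.isCycFunctor_cycFunctor⟩,
    fun _ hC => ⟨hC.faithful, hC.not_full⟩⟩
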